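/- Let $k\ge 0$ be an integer and $\kappa>0$. There is a constant $C>0$, depending only on $k$ and $\kappa$, such that the following holds. Let $\Omega\subset\mathbb R^3$ be a bounded domain with polyhedral Lipschitz boundary. Let $H_0(\mathrm{curl};\Omega)$ be the space of all $v\in L^2(\Omega)^3$ with $\mathrm{curl}\,v\in L^2(\Omega)^3$ and $v\times n=0$ on $\partial\Omega$, and let $(\lambda,u,\sigma)\in\mathbb R\times H_0(\mathrm{curl};\Omega)\times M$, $M:=\mathrm{curl}(H_0(\mathrm{curl};\Omega))$, $(u,\sigma)\ne 0$, be a solution of the mixed Maxwell eigenvalue problem $$(u,v)-(\mathrm{curl}\,v,\sigma)=0\quad\forall v\in H_0(\mathrm{curl};\Omega),\qquad -(\mathrm{curl}\,u,\tau)=-\lambda(\sigma,\tau)\quad\forall\tau\in M,$$ where $(\cdot,\cdot)$ is the $L^2(\Omega)$ inner product. Let $\mathcal T_h$ be a conforming partition of $\overline\Omega$ into finitely many tetrahedra, each $K\in\mathcal T_h$ containing a ball of some diameter $\rho>0$ with $h_K\le\kappa\rho$, where $h_S$ denotes the diameter of $S$. (Thus, for a regular family of meshes, $C$ is independent of the mesh.)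 Let $$N_h:=\{v\in H_0(\mathrm{curl};\Omega): v|_K\in[P_k]^3\oplus x\times[\tilde P_k]^3\ \ \forall K\in\mathcal T_h\},$$ with $P_k$ the polynomials of degree at most $k$ and $\tilde P_k$ the homogeneous polynomials of degree $k$, and let $(\lambda_h,u_h,\sigma_h)\in\mathbb R\times N_h\times\mathrm{curl}(N_h)$, $(u_h,\sigma_h)\ne0$, be a solution of the discrete problem $$(u_h,v_h)-(\mathrm{curl}\,v_h,\sigma_h)=0\quad\forall v_h\in N_h,\qquad -(\mathrm{curl}\,u_h,\tau_h)=-\lambda_h(\sigma_h,\tau_h)\quad\forall\tau_h\in\mathrm{curl}(N_h).$$ Let $\mathcal F_h^I$ be the set of the faces of the tetrahedra that lie in the interior of $\Omega$; for $F\in\mathcal F_h^I$ let $n_F$ be a unit normal to $F$ and let $[\![u_h\cdot n_F]\!]_F$ be the jump of $u_h\cdot n_F$ across $F$. Let $\|\cdot\|_{0,S}$ be the norm of $L^2(S)$, and for $K\in\mathcal T_h$ let $\eta_K\ge 0$ be the error indicator $$\eta_K^2:=h_K^2\|\mathrm{div}\,u_h\|_{0,K}^2+\sum_{F\in\mathcal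 F_h^I,\ F\subset\partial K}\frac{h_F}{4}\,\big\|[\![u_h\cdot n_F]\!]_F\big\|_{0,F}^2 ,$$ where the divergence is taken on $K$. Then: 1. for every $K\in\mathcal T_h$, $\ h_K\|\mathrm{div}\,u_h\|_{0,K}\le C\|u-u_h\|_{0,K}$; 2. for every $F\in\mathcal F_h^I$, $\ h_F^{1/2}\big\|[\![u_h\cdot n_F]\!]_F\big\|_{0,F}\le C\|u-u_h\|_{0,\tilde\omega_F}$, where $\tilde\omega_F$ is the union of the two tetrahedra sharing the face $F$; 3. for every $K\in\mathcal T_h$, $\ \eta_K\le C\|u-u_h\|_{0,\tilde\omega_K}$, where $\tilde\omega_K$ is the union of the tetrahedra sharing a face with $K$ (including $K$). -/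

import Mathlib

open MeasureTheory
open scoped ContDiff Matrix

noncomputable section

namespace MaxwellFE

/-- Euclidean three-space. -/
abbrev E3 : Type := EuclideanSpace ℝ (Fin 3)

/-- The norm of `g` in `L²(S)`, with respect to the measure `μ`. -/
def l2Norm {V : Type*} [NormedAddCommGroup V] (μ : Measure E3) (S : Set E3) (g : E3 → V) : ℝ :=
  Real.sqrt (∫ x in S, ‖g x‖ ^ 2 ∂μ)

/-! ### Domains -/

/-- The boundary of `Ω` is Lipschitz: near each boundary point, in suitable orthonormal
coordinates, `Ω` is the set of points lying strictly above the graph of a Lipschitz function. -/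
def HasLipschitzBoundary (Ω : Set E3) : Prop :=
  ∀ x ∈ frontier Ω, ∃ (e : E3 ≃ₗᵢ[ℝ] E3) (r : ℝ) (L : NNReal)
    (g : EuclideanSpace ℝ (Fin 2) → ℝ), 0 < r ∧ LipschitzWith L g ∧
      ∀ y ∈ Metric.ball x r, (y ∈ Ω ↔ g (!₂[e y 0, e y 1]) < e y 2)

/-- A bounded Lipschitz domain of `ℝ³`. (That it is polyhedral is expressed by the existence of a
tetrahedral mesh, see `TetMesh`.) -/
structure IsLipschitzDomain (Ω : Set E3) : Prop where
  isOpen : IsOpen Ω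
  isConnected : IsConnected Ω
  isBounded : Bornology.IsBounded Ω
  lipschitz : HasLipschitzBoundary Ω

/-! ### The space `H₀(curl; Ω)` and the mixed eigenvalue problem -/

/-- `j`-th partial derivative of the `i`-th component of a vector field. -/
def partialD (φ : E3 → E3) (j i : Fin 3) (x : E3) : ℝ :=
  (fderiv ℝ φ x (EuclideanSpace.single j 1)) i

/-- The classical curl of a differentiable vector field. -/
def curl (φ : E3 → E3) (x : E3) : E3 :=
  !₂[partialD φ 1 2 x - partialD φ 2 1 x,
     partialD φ 2 0 x - partialD φ 0 2 x,
     partialD φ 0 1 x - partialD φ 1 0 x]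

/-- `v ∈ H(curl; Ω)` and `curl v = c`, in the sense of distributions on `Ω`. -/
structure IsWeakCurl (Ω : Set E3) (v c : E3 → E3) : Prop where
  memLp : MemLp v 2 (volume.restrict Ω)
  memLp_curl : MemLp c 2 (volume.restrict Ω)
  integral_eq : ∀ φ : E3 → E3, ContDiff ℝ ∞ φ → HasCompactSupport φ → tsupport φ ⊆ Ω →
    ∫ x in Ω, inner ℝ (c x) (φ x) = ∫ x in Ω, inner ℝ (v x) (curl φ x)

/-- The tangential trace `v × n` of the field `v` with weak curl `c` vanishes on `∂Ω`: Green's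
formula for the curl holds without boundary term for all fields that are smooth up to the
boundary. -/
def HasZeroTangentialTrace (Ω : Set E3) (v c : E3 → E3) : Prop :=
  ∀ φ : E3 → E3, ContDiff ℝ ∞ φ → HasCompactSupport φ →
    ∫ x in Ω, inner ℝ (c x) (φ x) = ∫ x in Ω, inner ℝ (v x) (curl φ x)

/-- The space `H₀(curl; Ω)`. Its elements, like those of the other function spaces below, are
represented by functions, of which only the class modulo equality a.e. in `Ω` matters. -/
def H0curl (Ω : Set E3) : Set (E3 → E3) :=
  {v | ∃ c, IsWeakCurl Ω v c ∧ HasZeroTangentialTrace Ω v c}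

/-- The space `curl V` of the weak curls of the fields in `V`. -/
def curlSpace (Ω : Set E3) (V : Set (E3 → E3)) : Set (E3 → E3) :=
  {τ | ∃ v ∈ V, IsWeakCurl Ω v τ}

/-- `(lam, u, σ) ∈ ℝ × V × curl V`, `(u, σ) ≠ 0`, solves
`(u, v) - (curl v, σ) = 0` for all `v ∈ V`, and
`-(curl u, τ) = -lam (σ, τ)` for all `τ ∈ curl V`.
With `V = H₀(curl; Ω)` this is the mixed form of Maxwell's eigenvalue problem, with `V` the Nédélec
space it is its finite element discretization. -/
structure IsMixedEigensolution (Ω : Set E3) (V : Set (E3 → E3)) (lam : ℝ) (u σ : E3 → E3) :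
    Prop where
  mem_left : u ∈ V
  mem_right : σ ∈ curlSpace Ω V
  ne_zero : ¬ (u =ᵐ[volume.restrict Ω] 0 ∧ σ =ᵐ[volume.restrict Ω] 0)
  eq_left : ∀ v ∈ V, ∀ cv, IsWeakCurl Ω v cv →
    (∫ x in Ω, inner ℝ (u x) (v x)) - ∫ x in Ω, inner ℝ (cv x) (σ x) = 0
  eq_right : ∀ cu, IsWeakCurl Ω u cu → ∀ τ ∈ curlSpace Ω V,
    -(∫ x in Ω, inner ℝ (cu x) (τ x)) = -(lam * ∫ x in Ω, inner ℝ (σ x) (τ x))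

/-! ### Tetrahedral meshes -/

/-- The closed simplex with vertex set `S` (a tetrahedron, or a triangular face). -/
def hull (S : Finset E3) : Set E3 := convexHull ℝ (S : Set E3)

/-- The relative interior of the simplex with vertex set `S`. -/
def openSimplex (S : Finset E3) : Set E3 :=
  {x | ∃ w : E3 → ℝ, (∀ v ∈ S, 0 < w v) ∧ ∑ v ∈ S, w v = 1 ∧ ∑ v ∈ S, w v • v = x}

/-- A (conforming) partition of the closure of `Ω` into finitely many tetrahedra. A tetrahedron is
given by its set of vertices; two tetrahedra meet at most in the simplex spanned by their common
vertices. -/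
structure TetMesh (Ω : Set E3) where
  tets : Finset (Finset E3)
  card_eq : ∀ K ∈ tets, K.card = 4
  indep : ∀ K ∈ tets, AffineIndependent ℝ ((↑) : K → E3)
  conforming : ∀ K ∈ tets, ∀ K' ∈ tets,
    hull K ∩ hull K' ⊆ convexHull ℝ ((K : Set E3) ∩ (K' : Set E3))
  cover : closure Ω = ⋃ K ∈ tets, hull K

/-- The diameter `h_S` of the simplex with vertex set `S`. -/
def diam (S : Finset E3) : ℝ := Metric.diam (hull S)

/-- Shape regularity with constant `κ`: every tetrahedron `K` contains a ball of diameter `ρ > 0`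
with `h_K ≤ κ ρ`. A family of meshes is regular if a single `κ` serves for all of its members. -/
def TetMesh.IsShapeRegular {Ω : Set E3} (T : TetMesh Ω) (κ : ℝ) : Prop :=
  ∀ K ∈ T.tets, ∃ (z : E3) (r : ℝ), 0 < r ∧ Metric.closedBall z r ⊆ hull K ∧
    diam K ≤ κ * (2 * r)

/-- The faces of the tetrahedra of the mesh that lie in the interior of `Ω` (and not on its
boundary). -/
def TetMesh.interiorFaces {Ω : Set E3} (T : TetMesh Ω) : Set (Finset E3) :=
  {F | F.card = 3 ∧ (∃ K ∈ T.tets, F ⊆ K) ∧ openSimplex F ⊆ Ω}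

/-- The union of the (two) tetrahedra sharing the (interior) face `F`. -/
def TetMesh.facePatch {Ω : Set E3} (T : TetMesh Ω) (F : Finset E3) : Set E3 :=
  ⋃ K ∈ {K' ∈ T.tets | F ⊆ K'}, hull K

/-- The union of the tetrahedra sharing a face with `K` (among them `K` itself). -/
def TetMesh.elementPatch {Ω : Set E3} (T : TetMesh Ω) (K : Finset E3) : Set E3 :=
  ⋃ K' ∈ {K' : Finset E3 | K' ∈ T.tets ∧ ∃ F : Finset E3, F.card = 3 ∧ F ⊆ K ∧ F ⊆ K'}, hull K'

/-- `n` is a unit vector normal to the face `F`. -/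
def IsUnitNormal (F : Finset E3) (n : E3) : Prop :=
  ‖n‖ = 1 ∧ ∀ a ∈ F, ∀ b ∈ F, inner ℝ n (b - a) = 0

/-! ### Polynomial fields and the Nédélec space -/

/-- Polynomial vector fields on `ℝ³`. -/
abbrev PolyField : Type := Fin 3 → MvPolynomial (Fin 3) ℝ

/-- The value of a polynomial vector field at a point. -/
def PolyField.eval (p : PolyField) (x : E3) : E3 :=
  WithLp.toLp 2 fun i => MvPolynomial.eval (fun j => x j) (p i)

/-- The divergence of a polynomial vector field, as a function. -/
def PolyField.div (p : PolyField) (x : E3) : ℝ :=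
  MvPolynomial.eval (fun j => x j) (∑ i, MvPolynomial.pderiv i (p i))

/-- The local Nédélec space `[P_k]³ ⊕ x × [P̃_k]³`, where `P̃_k` are the homogeneous polynomials of
degree `k`. -/
def localNedelec (k : ℕ) : Set PolyField :=
  {p | ∃ q r : PolyField, (∀ i, (q i).totalDegree ≤ k) ∧ (∀ i, (r i).IsHomogeneous k) ∧
    p = q + ![MvPolynomial.X 0, MvPolynomial.X 1, MvPolynomial.X 2] ⨯₃ r}

/-- On each tetrahedron `K` of the mesh, the field `v` coincides with the polynomial field `p K`
of the local Nédélec space of order `k`. -/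
def TetMesh.IsPiecewise {Ω : Set E3} (T : TetMesh Ω) (k : ℕ) (v : E3 → E3)
    (p : Finset E3 → PolyField) : Prop :=
  ∀ K ∈ T.tets, p K ∈ localNedelec k ∧ v =ᵐ[volume.restrict (hull K)] (p K).eval

/-- The Nédélec finite element space of order `k` with vanishing tangential trace. -/
def TetMesh.nedelecSpace {Ω : Set E3} (T : TetMesh Ω) (k : ℕ) : Set (E3 → E3) :=
  {v | v ∈ H0curl Ω ∧ ∃ p, T.IsPiecewise k v p}

/-! ### The error indicators -/

/-- The side of the face `F` with normal `n` on which the tetrahedron `K` having `F` as a face lies: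
`1` if the vertex of `K` opposite to `F` is on the side into which `n` points, `-1` if it is on the
other side. -/
def side (n : E3) (F K : Finset E3) : ℝ :=
  open Classical in
  Real.sign (inner ℝ n ((∑ v ∈ K \ F, v) - (3 : ℝ)⁻¹ • ∑ v ∈ F, v))

/-- The jump `⟦u_h · n⟧_F` across the interior face `F` with unit normal `n` of the field `u_h` that
is given by `p K` on each `K`: the trace of `u_h · n` from the side into which `n` points, minus its
trace from the other side. -/
def TetMesh.normalJump {Ω : Set E3} (T : TetMesh Ω) (p : Finset E3 → PolyField) (n : E3)
    (F : Finset E3) (x : E3) : ℝ :=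
  ∑ K ∈ T.tets with F ⊆ K, side n F K * inner ℝ ((p K).eval x) n

/-- `‖⟦u_h · n⟧_F‖_{0,F}`, with respect to the surface measure on `F`. -/
def TetMesh.jumpNorm {Ω : Set E3} (T : TetMesh Ω) (p : Finset E3 → PolyField) (n : E3)
    (F : Finset E3) : ℝ :=
  l2Norm μHE[2] (hull F) (T.normalJump p n F)

/-- The local error indicator `η_K`, where `n F` is the unit normal chosen on the face `F`. -/
def TetMesh.indicator {Ω : Set E3} (T : TetMesh Ω) (p : Finset E3 → PolyField)
    (n : Finset E3 → E3) (K : Finset E3) : ℝ :=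
  open Classical in
  Real.sqrt (diam K ^ 2 * l2Norm volume (hull K) (p K).div ^ 2 +
    ∑ F ∈ K.powersetCard 3 with F ∈ T.interiorFaces,
      diam F / 4 * T.jumpNorm p (n F) F ^ 2)

end MaxwellFE

end

/-!
The gradient `∇ψ` of a smooth function with compact support in `Ω` lies in `H₀(curl; Ω)` and has
weak curl `0`, so the first equation of the eigenvalue problem says `(u, ∇ψ) = 0`. Hence the
quantity `(u_h, ∇ψ) = -(u - u_h, ∇ψ)` is bounded by the local error times `‖∇ψ‖`
(`abs_integral_inner_gradient_le`), and Green's formula expresses it by `div u_h` and the normal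
jumps of `u_h`.

Instead of bubble functions on a reference tetrahedron, the test functions are polynomials times a
smooth cut-off function of a ball. All constants come from the finite dimension of the space of
polynomials of bounded degree on the unit ball (`exists_sqrt_integral_le`: on such a space a seminorm
is dominated by any norm) and are transported by similarities.

* Divergence (`exists_ball_bound`, `exists_div_bound`). The element contains a ball whose radius is
  comparable to its diameter. With `ψ` equal to `div u_h` times the cut-off function of this ball,
  `(div u_h, ψ) = (u - u_h, ∇ψ)`, and `‖div u_h‖²` on the smaller ball, hence on the element, is
  controlled.
* Jumps (`exists_trace_bound`, `exists_jump_bound`). An interior face is shared by exactly two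
  tetrahedra, on different sides (`TetMesh.exists_two_tets`), by conformity of the mesh. Barycentric
  coordinates of a tetrahedron with inradius at least `r` have Lipschitz constant at most `1 / r`;
  therefore a ball around the barycentre of the face, with radius comparable to the diameter of the
  face, lies in the union of the two tetrahedra. With `ψ` equal to the jump, extended by a constant
  in the normal direction, times the cut-off function of this ball, Green's formula on both sides of
  the face (`integral_jump_eq`) bounds the jump by `u - u_h` and the divergences already estimated.

The `L²` norms of the error live on closed tetrahedra, while `u` is only known to be square
integrable on the open set `Ω`; the boundary of `Ω` is a null set, being contained in the boundaries
of finitely many tetrahedra (`TetMesh.ae_eq_closure`).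
-/

namespace MaxwellFE

/-! ### Square integrable functions -/

section SquareIntegrable

variable {α β X Y : Type*} [MeasurableSpace α] [MeasurableSpace β]
  [NormedAddCommGroup X] [NormedAddCommGroup Y] {μ : Measure α} {ν : Measure β}

lemma norm_toLp_two {f : α → X} (hf : MemLp f 2 μ) :
    ‖hf.toLp f‖ = Real.sqrt (∫ x, ‖f x‖ ^ 2 ∂μ) := by
  rw [Lp.norm_toLp, hf.eLpNorm_eq_integral_rpow_norm (by norm_num) (by norm_num),
    ENNReal.toReal_ofReal (by positivity), Real.sqrt_eq_rpow]
  norm_num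

lemma integral_norm_mul_norm_le {f : α → X} {g : α → Y} (hf : MemLp f 2 μ) (hg : MemLp g 2 μ) :
    ∫ x, ‖f x‖ * ‖g x‖ ∂μ ≤
      Real.sqrt (∫ x, ‖f x‖ ^ 2 ∂μ) * Real.sqrt (∫ x, ‖g x‖ ^ 2 ∂μ) := by
  have h := integral_mul_norm_le_Lp_mul_Lq (μ := μ) (f := fun x => ‖f x‖) (g := fun x => ‖g x‖)
    Real.HolderConjugate.two_two (by simpa using hf.norm) (by simpa using hg.norm)
  simpa [Real.sqrt_eq_rpow] using h

lemma integrable_norm_mul_norm {f : α → X} {g : α → Y} (hf : MemLp f 2 μ) (hg : MemLp g 2 μ) :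
    Integrable (fun x => ‖f x‖ * ‖g x‖) μ :=
  hf.norm.integrable_mul hg.norm

/-- On a finite-dimensional space an `L²` seminorm is dominated by any `L²` norm. -/
lemma exists_sqrt_integral_le {V : Type*} [AddCommGroup V] [Module ℝ V] [FiniteDimensional ℝ V]
    [NormedSpace ℝ X] [NormedSpace ℝ Y]
    (A : V →ₗ[ℝ] α → X) (B : V →ₗ[ℝ] β → Y) (hA : ∀ v, MemLp (A v) 2 μ)
    (hB : ∀ v, MemLp (B v) 2 ν) (inj : ∀ v, B v =ᵐ[ν] 0 → v = 0) :
    ∃ C : ℝ, 0 < C ∧ ∀ v, Real.sqrt (∫ x, ‖A v x‖ ^ 2 ∂μ) ≤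
      C * Real.sqrt (∫ x, ‖B v x‖ ^ 2 ∂ν) := by
  let A' : V →ₗ[ℝ] Lp X 2 μ :=
    { toFun := fun v => (hA v).toLp (A v)
      map_add' := fun v w => by
        rw [← MemLp.toLp_add]; exact MemLp.toLp_congr _ _ (by rw [map_add])
      map_smul' := fun c v => by
        rw [RingHom.id_apply, ← MemLp.toLp_const_smul]
        exact MemLp.toLp_congr _ _ (by rw [map_smul]) }
  let B' : V →ₗ[ℝ] Lp Y 2 ν :=
    { toFun := fun v => (hB v).toLp (B v)
      map_add' := fun v w => by
        rw [← MemLp.toLp_add]; exact MemLp.toLp_congr _ _ (by rw [map_add])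
      map_smul' := fun c v => by
        rw [RingHom.id_apply, ← MemLp.toLp_const_smul]
        exact MemLp.toLp_congr _ _ (by rw [map_smul]) }
  have hinj : Function.Injective B' := by
    rw [injective_iff_map_eq_zero]
    intro v hv
    apply inj
    have h1 := (hB v).coeFn_toLp
    have h2 : (hB v).toLp (B v) = 0 := hv
    rw [h2] at h1
    exact h1.symm.trans (Lp.coeFn_zero Y 2 ν)
  let e := LinearEquiv.ofInjective B' hinj
  let D : LinearMap.range B' →L[ℝ] Lp X 2 μ :=
    LinearMap.toContinuousLinearMap (A' ∘ₗ (e.symm : LinearMap.range B' →ₗ[ℝ] V))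
  refine ⟨‖D‖ + 1, by positivity, fun v => ?_⟩
  rw [← norm_toLp_two (hA v), ← norm_toLp_two (hB v)]
  have h := D.le_opNorm (e v)
  have h1 : D (e v) = (hA v).toLp (A v) := by
    change A' (e.symm (e v)) = _
    rw [e.symm_apply_apply]
    rfl
  have h2 : ‖e v‖ = ‖(hB v).toLp (B v)‖ := rfl
  rw [h1, h2] at h
  exact h.trans (by gcongr; linarith)

end SquareIntegrable

/-! ### Polynomial functions -/

section Polynomials

variable {ι ι' : Type*} [Fintype ι] [Fintype ι']

/-- The space of polynomial functions of degree at most `d` on `ℝ^ι`. -/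
noncomputable def polyFun (ι : Type*) [Fintype ι] (d : ℕ) : Submodule ℝ (EuclideanSpace ℝ ι → ℝ) :=
  (MvPolynomial.restrictTotalDegree ι ℝ d).map
    (LinearMap.pi fun x => (MvPolynomial.aeval fun j => x j).toLinearMap)

lemma mem_polyFun {d : ℕ} {f : EuclideanSpace ℝ ι → ℝ} :
    f ∈ polyFun ι d ↔ ∃ q : MvPolynomial ι ℝ, q.totalDegree ≤ d ∧
      ∀ x, f x = MvPolynomial.eval (fun j => x j) q := by
  simp only [polyFun, Submodule.mem_map, MvPolynomial.mem_restrictTotalDegree]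
  refine exists_congr fun q => and_congr_right fun _ => ?_
  rw [funext_iff]
  refine forall_congr' fun x => ?_
  simp [MvPolynomial.aeval_eq_eval, eq_comm]

instance (d : ℕ) : FiniteDimensional ℝ (polyFun ι d) := by
  unfold polyFun; infer_instance

lemma contDiff_of_mem_polyFun {d : ℕ} {f : EuclideanSpace ℝ ι → ℝ} (hf : f ∈ polyFun ι d)
    {n : WithTop ℕ∞} : ContDiff ℝ n f := by
  obtain ⟨q, -, hq⟩ := mem_polyFun.1 hf
  rw [funext hq]
  clear hq hf
  induction q using MvPolynomial.induction_on with
  | C a => simpa using contDiff_const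
  | add p q hp hq => simpa using hp.add hq
  | mul_X p i hp =>
    simp only [map_mul, MvPolynomial.eval_X]
    exact hp.mul (by fun_prop)

lemma affine_mem_polyFun (L : EuclideanSpace ℝ ι →ₗ[ℝ] ℝ) (c : ℝ) :
    (fun x => c + L x) ∈ polyFun ι 1 := by
  classical
  refine mem_polyFun.2 ⟨MvPolynomial.C c + ∑ j, MvPolynomial.C (L (EuclideanSpace.single j 1)) *
    MvPolynomial.X j, ?_, fun x => ?_⟩
  · refine (MvPolynomial.totalDegree_add _ _).trans (max_le (by simp) ?_)
    refine MvPolynomial.totalDegree_finsetSum_le fun j _ => ?_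
    refine (MvPolynomial.totalDegree_mul _ _).trans (by simp)
  · have hx : x = ∑ j, x j • EuclideanSpace.single j (1 : ℝ) := by
      ext i; simp [Finset.sum_apply, Pi.single_apply]
    conv_lhs => rw [hx]
    simp [map_sum, mul_comm]

lemma comp_mem_polyFun {d : ℕ} {f : EuclideanSpace ℝ ι → ℝ} (hf : f ∈ polyFun ι d)
    {A : EuclideanSpace ℝ ι' → EuclideanSpace ℝ ι} (hA : ∀ i, (fun y => A y i) ∈ polyFun ι' 1) :
    (fun y => f (A y)) ∈ polyFun ι' d := by
  obtain ⟨q, hqd, hq⟩ := mem_polyFun.1 hf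
  choose l hl hlA using fun i => mem_polyFun.1 (hA i)
  refine mem_polyFun.2 ⟨MvPolynomial.bind₁ l q, ?_, fun y => ?_⟩
  · rw [MvPolynomial.bind₁, MvPolynomial.aeval_def, MvPolynomial.eval₂_eq']
    refine MvPolynomial.totalDegree_finsetSum_le fun m hm => ?_
    refine (MvPolynomial.totalDegree_mul _ _).trans ?_
    rw [MvPolynomial.algebraMap_eq, MvPolynomial.totalDegree_C, zero_add]
    refine (MvPolynomial.totalDegree_finsetProd _ _).trans ?_
    refine le_trans ?_ ((MvPolynomial.le_totalDegree hm).trans hqd)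
    rw [Finsupp.sum_fintype _ _ (fun _ => rfl)]
    refine Finset.sum_le_sum fun i _ => ?_
    refine (MvPolynomial.totalDegree_pow _ _).trans ?_
    simpa using Nat.mul_le_mul_left (m i) (hl i)
  · rw [hq, ← MvPolynomial.coe_aeval_eq_eval, ← MvPolynomial.coe_aeval_eq_eval]
    simp only [RingHom.coe_coe, MvPolynomial.aeval_bind₁]
    congr 2
    funext i
    rw [hlA, ← MvPolynomial.coe_aeval_eq_eval]
    rfl

lemma eq_zero_of_mem_polyFun {d : ℕ} {f : EuclideanSpace ℝ ι → ℝ} (hf : f ∈ polyFun ι d)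
    {δ : ℝ} (hδ : 0 < δ) (h : ∀ x ∈ Metric.ball (0 : EuclideanSpace ℝ ι) δ, f x = 0) : f = 0 := by
  obtain ⟨q, -, hq⟩ := mem_polyFun.1 hf
  obtain ⟨ε, hε, hsub⟩ : ∃ ε > 0, Metric.ball (0 : ι → ℝ) ε ⊆
      WithLp.toLp 2 ⁻¹' Metric.ball (0 : EuclideanSpace ℝ ι) δ := by
    apply Metric.mem_nhds_iff.1
    refine ((PiLp.continuous_toLp 2 _).continuousAt).preimage_mem_nhds ?_
    simpa using Metric.ball_mem_nhds _ hδ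
  have : q = 0 := by
    refine MvPolynomial.funext_set (s := fun _ => Metric.ball (0 : ℝ) ε) (fun i => ?_)
      fun x hx => ?_
    · rw [Real.ball_eq_Ioo]
      exact Set.Ioo_infinite (by linarith)
    · have hx' : x ∈ Metric.ball (0 : ι → ℝ) ε := by
        rw [ball_pi _ hε]; exact hx
      have := h _ (hsub hx')
      rw [hq] at this
      simpa using this
  funext x
  simp [hq, this]

lemma totalDegree_pderiv_le (i : ι) (q : MvPolynomial ι ℝ) :
    (MvPolynomial.pderiv i q).totalDegree ≤ q.totalDegree := by
  classical
  conv_lhs => rw [q.as_sum, map_sum]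
  refine MvPolynomial.totalDegree_finsetSum_le fun m hm => ?_
  rw [MvPolynomial.pderiv_monomial]
  refine (MvPolynomial.totalDegree_monomial_le _ _).trans ?_
  refine le_trans ?_ (MvPolynomial.le_totalDegree hm)
  rw [Finsupp.sum_fintype _ _ (fun _ => rfl), Finsupp.sum_fintype _ _ (fun _ => rfl)]
  exact Finset.sum_le_sum fun j _ => by simp

end Polynomials

/-! ### Polynomial vector fields -/

lemma totalDegree_le_of_mem_localNedelec {k : ℕ} {p : PolyField} (hp : p ∈ localNedelec k)
    (i : Fin 3) : (p i).totalDegree ≤ k + 1 := by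
  obtain ⟨q, r, hq, hr, rfl⟩ := hp
  have h : ∀ a b, (MvPolynomial.X a * r b : MvPolynomial (Fin 3) ℝ).totalDegree ≤ k + 1 := by
    intro a b
    refine (MvPolynomial.totalDegree_mul _ _).trans ?_
    have := (hr b).totalDegree_le
    rw [MvPolynomial.totalDegree_X]
    omega
  rw [Pi.add_apply]
  refine (MvPolynomial.totalDegree_add _ _).trans (max_le ((hq i).trans (by omega)) ?_)
  rw [cross_apply]
  fin_cases i <;> exact (MvPolynomial.totalDegree_sub _ _).trans (max_le (h _ _) (h _ _))

lemma div_mem_polyFun {d : ℕ} {p : PolyField} (hp : ∀ i, (p i).totalDegree ≤ d) :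
    p.div ∈ polyFun (Fin 3) d := by
  refine mem_polyFun.2 ⟨∑ i, MvPolynomial.pderiv i (p i), ?_, fun x => rfl⟩
  exact MvPolynomial.totalDegree_finsetSum_le fun i _ => (totalDegree_pderiv_le _ _).trans (hp i)

lemma eval_apply_mem_polyFun {d : ℕ} {p : PolyField} (hp : ∀ i, (p i).totalDegree ≤ d)
    (i : Fin 3) : (fun x => p.eval x i) ∈ polyFun (Fin 3) d :=
  mem_polyFun.2 ⟨p i, hp i, fun _ => rfl⟩

lemma inner_eval_mem_polyFun {d : ℕ} {p : PolyField} (hp : ∀ i, (p i).totalDegree ≤ d) (n : E3) :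
    (fun x => inner ℝ (p.eval x) n) ∈ polyFun (Fin 3) d := by
  have : (fun x => inner ℝ (p.eval x) n) = ∑ i, n i • fun x => p.eval x i := by
    funext x
    simp [PiLp.inner_apply, Finset.sum_apply]
  rw [this]
  exact Submodule.sum_mem _ fun i _ => Submodule.smul_mem _ _ (eval_apply_mem_polyFun hp i)

lemma contDiff_eval_apply (p : PolyField) (i : Fin 3) {n : WithTop ℕ∞} :
    ContDiff ℝ n (fun x => p.eval x i) :=
  contDiff_of_mem_polyFun (mem_polyFun.2 ⟨p i, le_rfl, fun _ => rfl⟩)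

lemma continuous_eval (p : PolyField) : Continuous p.eval :=
  (PiLp.continuous_toLp 2 _).comp
    (continuous_pi fun i => (contDiff_eval_apply p i (n := 0)).continuous)

lemma continuous_div (p : PolyField) : Continuous p.div :=
  (contDiff_of_mem_polyFun (n := 0) (div_mem_polyFun (p := p) (d := ∑ i, (p i).totalDegree)
    fun i => Finset.single_le_sum (f := fun i => (p i).totalDegree) (fun _ _ => zero_le)
      (Finset.mem_univ i))).continuous

lemma fderiv_eval_single (q : MvPolynomial (Fin 3) ℝ) (x : E3) (j : Fin 3) :
    fderiv ℝ (fun x : E3 => MvPolynomial.eval (fun i => x i) q) x (EuclideanSpace.single j 1) =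
      MvPolynomial.eval (fun i => x i) (MvPolynomial.pderiv j q) := by
  have hd : ∀ q : MvPolynomial (Fin 3) ℝ,
      DifferentiableAt ℝ (fun x : E3 => MvPolynomial.eval (fun i => x i) q) x := fun q =>
    (contDiff_of_mem_polyFun (n := 1) (mem_polyFun.2 ⟨q, le_rfl, fun _ => rfl⟩)).differentiable
      (by norm_num) x
  induction q using MvPolynomial.induction_on with
  | C a => simp
  | add p q hp hq =>
    simp only [map_add]
    rw [fderiv_fun_add (hd p) (hd q), add_apply, hp, hq]
  | mul_X p i hp =>
    have hX : HasFDerivAt (fun x : E3 => x i) (EuclideanSpace.proj i : E3 →L[ℝ] ℝ) x :=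
      (EuclideanSpace.proj i : E3 →L[ℝ] ℝ).hasFDerivAt
    simp only [map_mul, MvPolynomial.eval_X, Derivation.leibniz, map_add, smul_eq_mul]
    rw [((hd p).hasFDerivAt.fun_mul hX).fderiv]
    simp [hp, MvPolynomial.pderiv_X, Pi.single_apply, eq_comm, apply_ite]

lemma inner_gradient (ψ : E3 → ℝ) (x v : E3) : inner ℝ v (gradient ψ x) = fderiv ℝ ψ x v := by
  rw [real_inner_comm, gradient, InnerProductSpace.toDual_symm_apply]

lemma norm_gradient (ψ : E3 → ℝ) (x : E3) : ‖gradient ψ x‖ = ‖fderiv ℝ ψ x‖ := by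
  simp [gradient]

/-- The product rule `div (ψ p) = p · ∇ψ + ψ div p`. -/
lemma sum_fderiv_mul_eval (p : PolyField) {ψ : E3 → ℝ} {x : E3} (hψ : DifferentiableAt ℝ ψ x) :
    ∑ j, fderiv ℝ (fun y => ψ y * p.eval y j) x (EuclideanSpace.single j 1) =
      inner ℝ (p.eval x) (gradient ψ x) + p.div x * ψ x := by
  have hd : ∀ j, DifferentiableAt ℝ (fun y => p.eval y j) x := fun j =>
    (contDiff_eval_apply p j (n := 1)).differentiable (by norm_num) x
  have h1 : ∀ j, fderiv ℝ (fun y => ψ y * p.eval y j) x (EuclideanSpace.single j 1) =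
      p.eval x j * fderiv ℝ ψ x (EuclideanSpace.single j 1) +
        ψ x * MvPolynomial.eval (fun i => x i) (MvPolynomial.pderiv j (p j)) := by
    intro j
    rw [fderiv_fun_mul hψ (hd j), ← fderiv_eval_single]
    simp [PolyField.eval]
    ring
  simp_rw [h1]
  rw [Finset.sum_add_distrib, inner_gradient, ← Finset.mul_sum, PolyField.div, map_sum,
    mul_comm (ψ x)]
  congr 1
  have hx : p.eval x = ∑ j, p.eval x j • EuclideanSpace.single j (1 : ℝ) := by
    ext i; simp [Finset.sum_apply, Pi.single_apply]
  conv_rhs => rw [hx]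
  simp [map_sum]

/-! ### Integration by parts -/

/-- Functions with compact support have no mean slope in a direction along which the weight `f` is
constant. -/
lemma integral_mul_fderiv_eq_zero {f g : E3 → ℝ} {v : E3} (hg : ContDiff ℝ 1 g)
    (hgs : HasCompactSupport g) (hfm : Measurable f) (hfb : ∀ x, |f x| ≤ 1)
    (hf : ∀ x (t : ℝ), f (x + t • v) = f x) : ∫ x, f x * fderiv ℝ g x v = 0 := by
  have hc : Continuous fun x => fderiv ℝ g x v :=
    (hg.continuous_fderiv (by norm_num)).clm_apply continuous_const
  have hs : HasCompactSupport fun x => fderiv ℝ g x v := hgs.fderiv_apply (𝕜 := ℝ) v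
  have key := integral_bilinear_hasLineDerivAt_right_eq_neg_left_of_integrable
    (μ := (volume : Measure E3)) (f := f) (f' := fun _ => 0) (g := g)
    (g' := fun x => fderiv ℝ g x v) (v := v) (B := ContinuousLinearMap.mul ℝ ℝ)
    (by simp)
    ((hc.integrable_of_hasCompactSupport hs).bdd_mul hfm.aestronglyMeasurable
      (Filter.Eventually.of_forall hfb))
    ((hg.continuous.integrable_of_hasCompactSupport hgs).bdd_mul hfm.aestronglyMeasurable
      (Filter.Eventually.of_forall hfb))
    (fun x _ => by
      have : (fun t : ℝ => f (x + t • v)) = fun _ => f x := funext (hf x)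
      rw [HasLineDerivAt, this]
      exact hasDerivAt_const _ _)
    (fun x _ => ((hg.differentiable (by norm_num)) x).hasFDerivAt.hasLineDerivAt v)
  simpa using key

/-- The isometric embedding of the plane into space as a coordinate plane. -/
noncomputable def planeEmb : EuclideanSpace ℝ (Fin 2) →ₗᵢ[ℝ] E3 where
  toFun s := !₂[s 0, s 1, 0]
  map_add' s t := by ext i; fin_cases i <;> simp
  map_smul' c s := by ext i; fin_cases i <;> simp
  norm_map' s := by simp [EuclideanSpace.norm_eq, Fin.sum_univ_succ]

lemma planeEmb_apply (s : EuclideanSpace ℝ (Fin 2)) : planeEmb s = !₂[s 0, s 1, 0] := rfl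

/-- Space as the product of a line and a plane. -/
noncomputable def lineProdPlane : ℝ × EuclideanSpace ℝ (Fin 2) ≃ᵐ E3 :=
  ((MeasurableEquiv.refl ℝ).prodCongr (MeasurableEquiv.toLp 2 (Fin 2 → ℝ)).symm).trans
    ((MeasurableEquiv.piFinSuccAbove (fun _ : Fin 3 => ℝ) 2).symm.trans
      (MeasurableEquiv.toLp 2 (Fin 3 → ℝ)))

lemma lineProdPlane_apply (t : ℝ) (s : EuclideanSpace ℝ (Fin 2)) :
    lineProdPlane (t, s) = planeEmb s + t • EuclideanSpace.single 2 1 := by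
  ext i
  have : lineProdPlane (t, s) = WithLp.toLp 2 (Fin.insertNth (α := fun _ => ℝ) 2 t s.ofLp) := rfl
  rw [this, planeEmb_apply]
  fin_cases i
  · simp [Fin.insertNth_apply_below (show (0 : Fin 3) < 2 by decide)]
  · simp [Fin.insertNth_apply_below (show (1 : Fin 3) < 2 by decide)]
  · simp

lemma measurePreserving_lineProdPlane : MeasurePreserving lineProdPlane := by
  have h := ((PiLp.volume_preserving_toLp (Fin 3)).comp
    ((volume_preserving_piFinSuccAbove (fun _ : Fin 3 => ℝ) 2).symm _)).comp
    ((MeasurePreserving.id volume).prod (PiLp.volume_preserving_ofLp (Fin 2)))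
  exact h

lemma integral_halfSpace_fderiv_single {g : E3 → ℝ} (hg : ContDiff ℝ 1 g)
    (hgs : HasCompactSupport g) :
    ∫ x in {x : E3 | 0 < x 2}, fderiv ℝ g x (EuclideanSpace.single 2 1) =
      -∫ s, g (planeEmb s) := by
  have hm : MeasurableSet {x : E3 | 0 < x 2} := measurableSet_lt measurable_const (by fun_prop)
  have hc : Continuous fun x => fderiv ℝ g x (EuclideanSpace.single 2 1) :=
    (hg.continuous_fderiv (by norm_num)).clm_apply continuous_const
  have hs : HasCompactSupport fun x => fderiv ℝ g x (EuclideanSpace.single 2 1) :=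
    hgs.fderiv_apply (𝕜 := ℝ) _
  have hint : Integrable ({x : E3 | 0 < x 2}.indicator
      fun x => fderiv ℝ g x (EuclideanSpace.single 2 1)) :=
    (hc.integrable_of_hasCompactSupport hs).indicator hm
  have hprod := integral_prod_symm _ ((measurePreserving_lineProdPlane.integrable_comp_emb
    lineProdPlane.measurableEmbedding).2 hint)
  rw [← integral_indicator hm, ← measurePreserving_lineProdPlane.integral_comp']
  refine hprod.trans ?_
  rw [← integral_neg]
  congr 1
  funext s
  have hf : ContDiff ℝ 1 fun t : ℝ => g (planeEmb s + t • EuclideanSpace.single 2 1) := by fun_prop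
  have hemb : Topology.IsClosedEmbedding
      fun t : ℝ => planeEmb s + t • EuclideanSpace.single (2 : Fin 3) (1 : ℝ) := by
    refine Isometry.isClosedEmbedding (Isometry.of_dist_eq fun a b => ?_)
    simp [dist_eq_norm, ← sub_smul, norm_smul]
  have hfs : HasCompactSupport fun t : ℝ => g (planeEmb s + t • EuclideanSpace.single 2 1) :=
    hgs.comp_isClosedEmbedding hemb
  have h := hfs.integral_Ioi_deriv_eq hf 0
  rw [zero_smul, add_zero] at h
  rw [← h, ← integral_indicator measurableSet_Ioi]
  congr 1
  funext t
  rw [Function.comp_apply, lineProdPlane_apply]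
  have hmem : planeEmb s + t • EuclideanSpace.single 2 1 ∈ {x : E3 | 0 < x 2} ↔ t ∈ Set.Ioi 0 := by
    simp [planeEmb_apply]
  have hderiv : deriv (fun t : ℝ => g (planeEmb s + t • EuclideanSpace.single 2 1)) t =
      fderiv ℝ g (planeEmb s + t • EuclideanSpace.single 2 1) (EuclideanSpace.single 2 1) := by
    have h1 : HasDerivAt (fun t : ℝ => planeEmb s + t • EuclideanSpace.single (2 : Fin 3) (1 : ℝ))
        (EuclideanSpace.single 2 1) t := by
      simpa using ((hasDerivAt_id t).smul_const
        (EuclideanSpace.single (2 : Fin 3) (1 : ℝ))).const_add (planeEmb s)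
    exact ((hg.differentiable (by norm_num) _).hasFDerivAt.comp_hasDerivAt t h1).deriv
  by_cases ht : t ∈ Set.Ioi (0 : ℝ)
  · rw [Set.indicator_of_mem ht, Set.indicator_of_mem (hmem.2 ht), hderiv]
  · rw [Set.indicator_of_notMem ht, Set.indicator_of_notMem (mt hmem.1 ht)]

lemma integral_halfSpace_fderiv {g : E3 → ℝ} (hg : ContDiff ℝ 1 g)
    (hgs : HasCompactSupport g) (v : E3) :
    ∫ x in {x : E3 | 0 < x 2}, fderiv ℝ g x v = -(v 2 * ∫ s, g (planeEmb s)) := by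
  have hm : MeasurableSet {x : E3 | 0 < x 2} := measurableSet_lt measurable_const (by fun_prop)
  have hint : ∀ w, Integrable (fun x => fderiv ℝ g x w) := fun w =>
    ((hg.continuous_fderiv (by norm_num)).clm_apply
      continuous_const).integrable_of_hasCompactSupport (hgs.fderiv_apply (𝕜 := ℝ) w)
  set w : E3 := v - v 2 • EuclideanSpace.single 2 1 with hw
  have hv : v = w + v 2 • EuclideanSpace.single 2 1 := by rw [hw]; abel
  have hw2 : w 2 = 0 := by simp [hw]
  -- The component of `v` parallel to the boundary of the half space does not contribute.
  have h0 : ∫ x in {x : E3 | 0 < x 2}, fderiv ℝ g x w = 0 := by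
    have h := integral_mul_fderiv_eq_zero (f := {x : E3 | 0 < x 2}.indicator 1) (v := w) hg hgs
      (measurable_one.indicator hm)
      (fun x => by by_cases hx : 0 < x 2 <;> simp [Set.indicator, hx])
      (fun x t => by simp [Set.indicator, hw2])
    rw [← integral_indicator hm]
    refine Eq.trans (integral_congr_ae (Filter.Eventually.of_forall fun x => ?_)) h
    by_cases hx : 0 < x 2 <;> simp [Set.indicator, hx]
  conv_lhs => rw [hv]
  simp only [map_add, map_smul, smul_eq_mul]
  rw [integral_add (hint w).integrableOn ((hint _).const_mul _).integrableOn, h0, zero_add,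
    integral_const_mul, integral_halfSpace_fderiv_single hg hgs, mul_neg]

/-- The rigid motion taking `z` to the origin whose linear part is `e`. -/
noncomputable def rigid (e : E3 ≃ₗᵢ[ℝ] E3) (z : E3) : E3 ≃ᵐ E3 :=
  ((Homeomorph.subRight z).trans e.toHomeomorph).toMeasurableEquiv

lemma rigid_apply (e : E3 ≃ₗᵢ[ℝ] E3) (z x : E3) : rigid e z x = e (x - z) := rfl

lemma measurePreserving_rigid (e : E3 ≃ₗᵢ[ℝ] E3) (z : E3) : MeasurePreserving (rigid e z) :=
  by
  have h := e.measurePreserving.comp (measurePreserving_sub_right (volume : Measure E3) z)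
  exact h

/-- The open half space of the points `x` for which the last coordinate of `e (x - z)` is
positive. -/
def halfSpace (e : E3 ≃ₗᵢ[ℝ] E3) (z : E3) : Set E3 := {x | 0 < e (x - z) 2}

lemma measurableSet_halfSpace (e : E3 ≃ₗᵢ[ℝ] E3) (z : E3) : MeasurableSet (halfSpace e z) := by
  refine (isOpen_lt continuous_const ?_).measurableSet
  exact (EuclideanSpace.proj (𝕜 := ℝ) (2 : Fin 3)).continuous.comp
    (e.continuous.comp (continuous_id.sub continuous_const))

lemma integral_halfSpace_fderiv_rigid {g : E3 → ℝ} (hg : ContDiff ℝ 1 g)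
    (hgs : HasCompactSupport g) (e : E3 ≃ₗᵢ[ℝ] E3) (z v : E3) :
    ∫ x in halfSpace e z, fderiv ℝ g x v = -(e v 2 * ∫ s, g (z + e.symm (planeEmb s))) := by
  have hT : Topology.IsClosedEmbedding fun y => z + e.symm y :=
    (e.symm.toHomeomorph.trans (Homeomorph.addLeft z)).isClosedEmbedding
  have hg' : ContDiff ℝ 1 fun y => g (z + e.symm y) :=
    hg.comp (contDiff_const.add e.symm.contDiff)
  have key : ∀ x, fderiv ℝ g x v =
      fderiv ℝ (fun y => g (z + e.symm y)) (rigid e z x) (e v) := fun x => by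
    have h1 : HasFDerivAt (𝕜 := ℝ) (fun y => z + e.symm y)
        (e.symm.toContinuousLinearEquiv : E3 →L[ℝ] E3) (rigid e z x) :=
      (ContinuousLinearEquiv.hasFDerivAt (𝕜 := ℝ) (E := E3) (F := E3)
        e.symm.toContinuousLinearEquiv).const_add z
    have h2 : z + e.symm (rigid e z x) = x := by simp [rigid_apply]
    have h3 := (hg.differentiable (by norm_num) (z + e.symm (rigid e z x))).hasFDerivAt.comp
      (rigid e z x) h1
    have h4 : fderiv ℝ (fun y => g (z + e.symm y)) (rigid e z x) = _ := h3.fderiv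
    rw [h4, h2, ContinuousLinearMap.comp_apply]
    congr 1
    exact (e.symm_apply_apply v).symm
  simp_rw [key]
  rw [← integral_halfSpace_fderiv hg' (hgs.comp_isClosedEmbedding hT) (e v)]
  exact (measurePreserving_rigid e z).setIntegral_preimage_emb (rigid e z).measurableEmbedding
    (fun y => fderiv ℝ (fun y => g (z + e.symm y)) y (e v)) {x : E3 | 0 < x 2}

lemma integrable_mul_of_hasCompactSupport {f ψ : E3 → ℝ} (hf : Continuous f) (hψ : Continuous ψ)
    (hψs : HasCompactSupport ψ) : Integrable fun x => f x * ψ x :=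
  (hf.mul hψ).integrable_of_hasCompactSupport hψs.mul_left

lemma continuous_gradient {ψ : E3 → ℝ} (hψ : ContDiff ℝ 1 ψ) : Continuous (gradient ψ) :=
  (InnerProductSpace.toDual ℝ E3).symm.continuous.comp (hψ.continuous_fderiv (by norm_num))

lemma hasCompactSupport_gradient {ψ : E3 → ℝ} (hψs : HasCompactSupport ψ) :
    HasCompactSupport (gradient ψ) :=
  (hψs.fderiv (𝕜 := ℝ)).comp_left (map_zero _)

lemma integrable_inner_gradient {v : E3 → E3} {ψ : E3 → ℝ} (hv : Continuous v)
    (hψ : ContDiff ℝ 1 ψ) (hψs : HasCompactSupport ψ) :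
    Integrable fun x => inner ℝ (v x) (gradient ψ x) := by
  refine (hv.inner (continuous_gradient hψ)).integrable_of_hasCompactSupport ?_
  refine (hasCompactSupport_gradient hψs).mono fun x hx => ?_
  contrapose! hx
  rw [Function.notMem_support] at hx ⊢
  rw [hx, inner_zero_right]

lemma mul_eval_support {p : PolyField} {ψ : E3 → ℝ} (hψs : HasCompactSupport ψ) (j : Fin 3) :
    HasCompactSupport fun x => ψ x * p.eval x j :=
  hψs.mul_right

lemma integrable_fderiv_mul_eval (p : PolyField) {ψ : E3 → ℝ} (hψ : ContDiff ℝ 1 ψ)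
    (hψs : HasCompactSupport ψ) (j : Fin 3) (v : E3) :
    Integrable fun x => fderiv ℝ (fun y => ψ y * p.eval y j) x v :=
  (((hψ.mul (contDiff_eval_apply p j)).continuous_fderiv (by norm_num)).clm_apply
    continuous_const).integrable_of_hasCompactSupport
      ((mul_eval_support hψs j).fderiv_apply (𝕜 := ℝ) v)

/-- Green's formula in the whole space. -/
lemma integral_inner_gradient (p : PolyField) {ψ : E3 → ℝ} (hψ : ContDiff ℝ 1 ψ)
    (hψs : HasCompactSupport ψ) :
    ∫ x, inner ℝ (p.eval x) (gradient ψ x) = -∫ x, p.div x * ψ x := by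
  rw [eq_neg_iff_add_eq_zero, ← integral_add (integrable_inner_gradient (continuous_eval p) hψ hψs)
    (integrable_mul_of_hasCompactSupport (continuous_div p) hψ.continuous hψs)]
  simp_rw [← sum_fderiv_mul_eval p (hψ.differentiable (by norm_num) _)]
  rw [integral_finsetSum _ fun j _ => integrable_fderiv_mul_eval p hψ hψs j _]
  refine Finset.sum_eq_zero fun j _ => ?_
  simpa using integral_mul_fderiv_eq_zero (f := fun _ => 1) (v := EuclideanSpace.single j 1)
    (hψ.mul (contDiff_eval_apply p j)) (mul_eval_support hψs j) measurable_const (by simp) (by simp)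

/-- Green's formula in a half space with inner unit normal `n`. -/
lemma setIntegral_halfSpace_inner_gradient (p : PolyField) {ψ : E3 → ℝ} (hψ : ContDiff ℝ 1 ψ)
    (hψs : HasCompactSupport ψ) {e : E3 ≃ₗᵢ[ℝ] E3} {n : E3}
    (hn : e n = EuclideanSpace.single 2 1) (z : E3) :
    ∫ x in halfSpace e z, inner ℝ (p.eval x) (gradient ψ x) =
      -(∫ x in halfSpace e z, p.div x * ψ x) -
        ∫ s, inner ℝ (p.eval (z + e.symm (planeEmb s))) n * ψ (z + e.symm (planeEmb s)) := by
  have hev : ∀ v, e v 2 = inner ℝ v n := fun v => by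
    rw [← e.inner_map_map, hn, EuclideanSpace.inner_single_right]; simp
  rw [eq_sub_iff_add_eq, eq_neg_iff_add_eq_zero, add_right_comm,
    ← integral_add (integrable_inner_gradient (continuous_eval p) hψ hψs).integrableOn
    (integrable_mul_of_hasCompactSupport (continuous_div p) hψ.continuous hψs).integrableOn]
  simp_rw [← sum_fderiv_mul_eval p (hψ.differentiable (by norm_num) _)]
  rw [integral_finsetSum _ fun j _ => (integrable_fderiv_mul_eval p hψ hψs j _).integrableOn]
  simp_rw [integral_halfSpace_fderiv_rigid (hψ.mul (contDiff_eval_apply p _))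
    (mul_eval_support hψs _) e z, hev]
  have hT : Topology.IsClosedEmbedding fun s => z + e.symm (planeEmb s) :=
    ((e.symm.toHomeomorph.trans (Homeomorph.addLeft z)).isClosedEmbedding).comp
      planeEmb.isometry.isClosedEmbedding
  rw [Finset.sum_neg_distrib, neg_add_eq_zero]
  simp_rw [← integral_const_mul]
  rw [← integral_finsetSum]
  · congr 1
    funext s
    simp only [PiLp.inner_apply, Finset.sum_mul]
    refine Finset.sum_congr rfl fun j _ => ?_
    simp
    ring
  · intro j _
    refine Integrable.const_mul ?_ _
    refine Continuous.integrable_of_hasCompactSupport ?_ ?_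
    · exact (hψ.mul (contDiff_eval_apply p j (n := 1))).continuous.comp hT.continuous
    · exact (mul_eval_support (p := p) hψs j).comp_isClosedEmbedding hT

/-! ### Barycentric coordinates -/

/-- `lam v`, for `v ∈ K`, are the barycentric coordinates of the tetrahedron with vertex set `K`. -/
structure IsBarycentric (K : Finset E3) (lam : E3 → E3 →ᵃ[ℝ] ℝ) : Prop where
  apply_self : ∀ v ∈ K, lam v v = 1
  apply_ne : ∀ v ∈ K, ∀ w ∈ K, w ≠ v → lam v w = 0
  sum_eq : ∀ x, ∑ v ∈ K, lam v x = 1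
  sum_smul : ∀ x, ∑ v ∈ K, lam v x • v = x
  mem_hull : ∀ x, x ∈ hull K ↔ ∀ v ∈ K, 0 ≤ lam v x

lemma exists_isBarycentric {K : Finset E3} (hcard : K.card = 4)
    (hind : AffineIndependent ℝ ((↑) : K → E3)) : ∃ lam, IsBarycentric K lam := by
  classical
  have htop : affineSpan ℝ (Set.range ((↑) : K → E3)) = ⊤ := by
    rw [hind.affineSpan_eq_top_iff_card_eq_finrank_add_one]
    simp [hcard]
  let b : AffineBasis K ℝ E3 := ⟨(↑), hind, htop⟩
  have hb : ∀ v : K, b v = v := fun _ => rfl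
  refine ⟨fun v => if hv : v ∈ K then b.coord ⟨v, hv⟩ else 0, ?_, ?_, ?_, ?_, ?_⟩
  · intro v hv
    simp only [hv, dif_pos]
    exact b.coord_apply_eq ⟨v, hv⟩
  · intro v hv w hw hne
    simp only [hv, dif_pos]
    exact b.coord_apply_ne (i := ⟨v, hv⟩) (j := ⟨w, hw⟩) (by simpa [eq_comm] using hne)
  · intro x
    rw [← Finset.sum_coe_sort]
    simpa using b.sum_coord_apply_eq_one x
  · intro x
    rw [← Finset.sum_coe_sort]
    simpa [hb] using b.linear_combination_coord_eq_self x
  · intro x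
    have h := b.convexHull_eq_nonneg_coord
    have hr : Set.range b = (K : Set E3) := by
      ext y; simp [hb, Set.mem_range]
    rw [hull, ← hr, h]
    constructor
    · intro hx v hv
      simpa [hv] using hx ⟨v, hv⟩
    · intro hx v
      simpa using hx v v.2

/-- The barycentre of the triangle with vertex set `F`. -/
noncomputable def faceCenter (F : Finset E3) : E3 := (3 : ℝ)⁻¹ • ∑ v ∈ F, v

lemma faceCenter_mem_openSimplex {F : Finset E3} (hF : F.card = 3) :
    faceCenter F ∈ openSimplex F :=
  ⟨fun _ => 3⁻¹, fun _ _ => by norm_num, by simp [hF], by rw [faceCenter, Finset.smul_sum]⟩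

lemma faceCenter_mem_hull {F : Finset E3} (hF : F.card = 3) : faceCenter F ∈ hull F := by
  rw [faceCenter, Finset.smul_sum]
  exact (convex_convexHull ℝ _).sum_mem (fun _ _ => by norm_num) (by simp [hF])
    fun v hv => subset_convexHull ℝ _ hv

lemma affine_sum_smul (f : E3 →ᵃ[ℝ] ℝ) {S : Finset E3} {w : E3 → ℝ} (hw : ∑ v ∈ S, w v = 1) :
    f (∑ v ∈ S, w v • v) = ∑ v ∈ S, w v * f v := by
  have h := Finset.map_affineCombination S (id : E3 → E3) w hw f
  rw [Finset.affineCombination_eq_linear_combination _ _ _ hw,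
    Finset.affineCombination_eq_linear_combination _ _ _ hw] at h
  simpa using h

lemma affine_faceCenter (f : E3 →ᵃ[ℝ] ℝ) {F : Finset E3} (hF : F.card = 3) :
    f (faceCenter F) = ∑ v ∈ F, 3⁻¹ * f v := by
  rw [faceCenter, Finset.smul_sum]
  exact affine_sum_smul f (w := fun _ => 3⁻¹) (by simp [hF])

/-- The height of a point over the plane of the face `F` with normal `n`. -/
noncomputable def height (n : E3) (F : Finset E3) : E3 →ᵃ[ℝ] ℝ :=
  (innerSL ℝ n).toLinearMap.toAffineMap - AffineMap.const ℝ E3 (inner ℝ n (faceCenter F))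

lemma height_apply (n : E3) (F : Finset E3) (x : E3) :
    height n F x = inner ℝ n (x - faceCenter F) := by
  simp [height, inner_sub_right]

lemma height_vertex {n : E3} {F : Finset E3} (hF : F.card = 3) (hn : IsUnitNormal F n)
    {v : E3} (hv : v ∈ F) : height n F v = 0 := by
  have h1 : v - faceCenter F = ∑ w ∈ F, (3 : ℝ)⁻¹ • (v - w) := by
    rw [faceCenter, ← Finset.smul_sum, Finset.sum_sub_distrib, Finset.sum_const, hF, smul_sub,
      ← Nat.cast_smul_eq_nsmul ℝ, smul_smul]
    norm_num
  rw [height_apply, h1, inner_sum]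
  exact Finset.sum_eq_zero fun w hw => by rw [inner_smul_right, hn.2 w hw v hv, mul_zero]

namespace IsBarycentric

variable {K : Finset E3} {lam : E3 → E3 →ᵃ[ℝ] ℝ}

lemma le_one (h : IsBarycentric K lam) {x v : E3} (hx : x ∈ hull K) (hv : v ∈ K) :
    lam v x ≤ 1 := by
  rw [← h.sum_eq x]
  exact Finset.single_le_sum (f := fun v => lam v x) (fun w hw => (h.mem_hull x).1 hx w hw) hv

/-- The barycentric coordinates of a tetrahedron that contains a ball of radius `r` are Lipschitz
continuous with constant `1 / r`. -/
lemma abs_sub_le (h : IsBarycentric K lam) {z : E3} {r : ℝ} (hr : 0 < r)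
    (hball : Metric.closedBall z r ⊆ hull K) {v : E3} (hv : v ∈ K) (x y : E3) :
    |lam v x - lam v y| ≤ dist x y / r := by
  rcases eq_or_ne x y with rfl | hne
  · simp
  have hd : 0 < dist x y := dist_pos.2 hne
  set w : E3 := (r / dist x y) • (x - y) with hw
  have hwn : ‖w‖ = r := by
    rw [hw, norm_smul, ← dist_eq_norm, Real.norm_of_nonneg (by positivity)]
    field_simp
  have h1 : z + w ∈ hull K := hball (by simp [hwn])
  have h2 : z ∈ hull K := hball (by simp [hr.le])
  have e1 : lam v (z + w) - lam v z = (lam v).linear w := by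
    rw [← vsub_eq_sub, ← AffineMap.linearMap_vsub]; simp
  have e2 : lam v x - lam v y = (lam v).linear (x - y) := by
    rw [← vsub_eq_sub, ← AffineMap.linearMap_vsub]; simp
  have h3 : |(lam v).linear w| ≤ 1 := by
    rw [← e1, abs_le]
    constructor <;> linarith [h.le_one h1 hv, h.le_one h2 hv, (h.mem_hull _).1 h1 v hv,
      (h.mem_hull _).1 h2 v hv]
  rw [hw, map_smul, smul_eq_mul, abs_mul, abs_of_pos (by positivity), ← e2] at h3
  rw [le_div_iff₀ hr]
  calc |lam v x - lam v y| * r = dist x y * (r / dist x y * |lam v x - lam v y|) := by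
        field_simp
    _ ≤ dist x y * 1 := by gcongr
    _ = dist x y := mul_one _

lemma le_dist (h : IsBarycentric K lam) {z : E3} {r : ℝ} (hr : 0 < r)
    (hball : Metric.closedBall z r ⊆ hull K) {v w : E3} (hv : v ∈ K) (hw : w ∈ K) (hne : w ≠ v) :
    r ≤ dist v w := by
  have h1 := h.abs_sub_le hr hball hv v w
  rw [h.apply_self v hv, h.apply_ne v hv w hw hne, sub_zero, abs_one, le_div_iff₀ hr] at h1
  linarith

lemma apply_faceCenter (h : IsBarycentric K lam) {F : Finset E3} (hF : F.card = 3) (hFK : F ⊆ K)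
    {v : E3} (hv : v ∈ F) : lam v (faceCenter F) = 3⁻¹ := by
  rw [affine_faceCenter _ hF, Finset.sum_eq_single v, h.apply_self v (hFK hv), mul_one]
  · intro w hw hne
    rw [h.apply_ne v (hFK hv) w (hFK hw) hne, mul_zero]
  · exact fun h' => absurd hv h'

variable {F : Finset E3} {a n : E3}

lemma apply_eq_zero_of_mem_convexHull (h : IsBarycentric K lam) {S : Set E3} {x v : E3} (hv : v ∈ K)
    (hS : S ⊆ K) (hvS : v ∉ S) (hx : x ∈ convexHull ℝ S) : lam v x = 0 := by
  have hc : Convex ℝ {y | lam v y = 0} :=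
    (convex_singleton (0 : ℝ)).affine_preimage (lam v)
  exact convexHull_min (fun w hw => h.apply_ne v hv w (hS hw) (fun e => hvS (e ▸ hw))) hc hx

lemma height_eq (h : IsBarycentric K lam) (hF : F.card = 3) (haF : a ∉ F)
    (hK : K = insert a F) (hn : IsUnitNormal F n) (x : E3) :
    height n F x = lam a x * height n F a := by
  conv_lhs => rw [← h.sum_smul x]
  rw [affine_sum_smul _ (h.sum_eq x), hK, Finset.sum_insert haF, Finset.sum_eq_zero, add_zero]
  intro v hv
  rw [height_vertex hF hn hv, mul_zero]

lemma height_apex_ne_zero (h : IsBarycentric K lam) (hF : F.card = 3)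
    (haF : a ∉ F) (hK : K = insert a F) (hn : IsUnitNormal F n) : height n F a ≠ 0 := by
  intro h0
  have h1 := h.height_eq hF haF hK hn (faceCenter F + n)
  rw [h0, mul_zero, height_apply, add_sub_cancel_left, real_inner_self_eq_norm_sq, hn.1] at h1
  norm_num at h1

/-- Around the barycentre of a face, a half ball whose radius is a third of the inradius lies in the
tetrahedron. -/
lemma mem_hull_of_dist_le (h : IsBarycentric K lam) {z : E3} {r : ℝ} (hr : 0 < r)
    (hball : Metric.closedBall z r ⊆ hull K) (hF : F.card = 3) (haF : a ∉ F)
    (hK : K = insert a F) (hn : IsUnitNormal F n) {x : E3} (hx : dist x (faceCenter F) ≤ r / 3)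
    (hside : 0 ≤ height n F x * height n F a) : x ∈ hull K := by
  rw [h.mem_hull]
  intro v hv
  by_cases hvF : v ∈ F
  · have h1 := h.abs_sub_le hr hball hv x (faceCenter F)
    rw [h.apply_faceCenter hF (hK ▸ Finset.subset_insert a F) hvF] at h1
    have h2 : dist x (faceCenter F) / r ≤ 3⁻¹ := by
      rw [div_le_iff₀ hr]; linarith
    linarith [(abs_le.1 h1).1]
  · have : v = a := by
      rw [hK, Finset.mem_insert] at hv
      exact hv.resolve_right hvF
    subst this
    rw [h.height_eq hF haF hK hn x, mul_assoc] at hside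
    have := h.height_apex_ne_zero hF haF hK hn
    exact nonneg_of_mul_nonneg_left hside (mul_self_pos.2 this)

end IsBarycentric

lemma isBounded_hull (S : Finset E3) : Bornology.IsBounded (hull S) :=
  (isBounded_convexHull (E := E3)).2 S.finite_toSet.isBounded

lemma isCompact_hull (S : Finset E3) : IsCompact (hull S) :=
  S.finite_toSet.isCompact_convexHull (𝕜 := ℝ)

lemma hull_mono {S S' : Finset E3} (h : S ⊆ S') : hull S ⊆ hull S' :=
  convexHull_mono (Finset.coe_subset.2 h)

lemma diam_mono {S S' : Finset E3} (h : S ⊆ S') : diam S ≤ diam S' :=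
  Metric.diam_mono (hull_mono h) (isBounded_hull S')

lemma diam_nonneg (S : Finset E3) : 0 ≤ diam S := Metric.diam_nonneg

lemma hull_subset_closedBall {S : Finset E3} {x : E3} (hx : x ∈ hull S) :
    hull S ⊆ Metric.closedBall x (diam S) :=
  fun _ hy => Metric.dist_le_diam_of_mem (isBounded_hull S) hy hx

/-! ### Tetrahedra sharing a face -/

lemma exists_apex {F K : Finset E3} (hF : F.card = 3) (hK : K.card = 4)
    (hFK : F ⊆ K) : ∃ a, a ∉ F ∧ K = insert a F := by
  have h : (K \ F).card = 1 := by rw [Finset.card_sdiff_of_subset hFK]; omega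
  obtain ⟨a, ha⟩ := Finset.card_eq_one.1 h
  refine ⟨a, fun haF => ?_, ?_⟩
  · have : a ∈ K \ F := by rw [ha]; exact Finset.mem_singleton_self a
    exact (Finset.mem_sdiff.1 this).2 haF
  · rw [← Finset.sdiff_union_of_subset hFK, ha]; rfl

lemma side_insert {F : Finset E3} {a : E3} (haF : a ∉ F) (n : E3) :
    side n F (insert a F) = Real.sign (height n F a) := by
  rw [side, height_apply, faceCenter, Finset.insert_sdiff_of_notMem _ haF, Finset.sdiff_self,
    insert_empty_eq, Finset.sum_singleton]

lemma height_neg (n : E3) (F : Finset E3) (x : E3) : height (-n) F x = -height n F x := by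
  simp [height_apply]

lemma IsUnitNormal.neg {F : Finset E3} {n : E3} (hn : IsUnitNormal F n) : IsUnitNormal F (-n) :=
  ⟨by rw [norm_neg, hn.1], fun a ha b hb => by rw [inner_neg_left, hn.2 a ha b hb, neg_zero]⟩

namespace TetMesh

variable {Ω : Set E3} (T : TetMesh Ω) {F : Finset E3} {n : E3}

lemma subset_of_faceCenter_mem {K K' : Finset E3} (hK : K ∈ T.tets) (hK' : K' ∈ T.tets)
    (hF : F.card = 3) (hFK : F ⊆ K) (hmem : faceCenter F ∈ hull K') : F ⊆ K' := by
  obtain ⟨lam, hlam⟩ := exists_isBarycentric (T.card_eq K hK) (T.indep K hK)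
  intro v hv
  by_contra hvK'
  have h1 := T.conforming K hK K' hK' ⟨hull_mono hFK (faceCenter_mem_hull hF), hmem⟩
  have h2 := hlam.apply_eq_zero_of_mem_convexHull (hFK hv) Set.inter_subset_left
    (fun h => hvK' h.2) h1
  rw [hlam.apply_faceCenter hF hFK hv] at h2
  norm_num at h2

/-- There is a tetrahedron on that side of an interior face into which the normal points. -/
lemma exists_tet_of_normal (hΩ : IsOpen Ω) (hF : F ∈ T.interiorFaces)
    (hn : IsUnitNormal F n) :
    ∃ a, a ∉ F ∧ insert a F ∈ T.tets ∧ 0 < height n F a := by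
  obtain ⟨hF3, ⟨K₀, hK₀, hFK₀⟩, hFΩ⟩ := hF
  have hcΩ : faceCenter F ∈ Ω := hFΩ (faceCenter_mem_openSimplex hF3)
  have hcont : Continuous fun ε : ℝ => faceCenter F + ε • n := by fun_prop
  -- A tetrahedron meets the ray along the normal in points arbitrarily close to the face.
  obtain ⟨K, hK, hfreq⟩ : ∃ K ∈ T.tets,
      ∃ᶠ ε in nhdsWithin (0 : ℝ) (Set.Ioi 0), faceCenter F + ε • n ∈ hull K := by
    by_contra! hcon
    have h1 : ∀ᶠ ε in nhdsWithin (0 : ℝ) (Set.Ioi 0), ∀ K ∈ T.tets,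
        faceCenter F + ε • n ∉ hull K :=
      (Filter.eventually_all_finset _).2 hcon
    have h2 : ∀ᶠ ε in nhdsWithin (0 : ℝ) (Set.Ioi 0), faceCenter F + ε • n ∈ Ω :=
      nhdsWithin_le_nhds (hcont.continuousAt.preimage_mem_nhds
        (hΩ.mem_nhds (by simpa using hcΩ)))
    obtain ⟨ε, hε1, hε2⟩ := (h1.and h2).exists
    have h3 : faceCenter F + ε • n ∈ closure Ω := subset_closure hε2
    rw [T.cover, Set.mem_iUnion₂] at h3
    obtain ⟨K, hK, hmem⟩ := h3
    exact hε1 K hK hmem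
  have hmem : faceCenter F ∈ hull K := by
    have h1 : IsClosed ((fun ε : ℝ => faceCenter F + ε • n) ⁻¹' hull K) :=
      (isCompact_hull K).isClosed.preimage hcont
    have h2 := h1.mem_of_frequently_of_tendsto hfreq
      (Filter.tendsto_id.mono_left nhdsWithin_le_nhds)
    simpa using h2
  have hFK := T.subset_of_faceCenter_mem hK₀ hK hF3 hFK₀ hmem
  obtain ⟨a, haF, hKa⟩ := exists_apex hF3 (T.card_eq K hK) hFK
  refine ⟨a, haF, hKa ▸ hK, ?_⟩
  obtain ⟨lam, hlam⟩ := exists_isBarycentric (T.card_eq K hK) (T.indep K hK)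
  obtain ⟨ε, hε1, hε2⟩ := (hfreq.and_eventually self_mem_nhdsWithin).exists
  have h1 := hlam.height_eq hF3 haF hKa hn (faceCenter F + ε • n)
  have h2 := (hlam.mem_hull _).1 hε1 a (hKa ▸ Finset.mem_insert_self a F)
  rw [height_apply, add_sub_cancel_left, inner_smul_right, real_inner_self_eq_norm_sq, hn.1] at h1
  have hε : (0 : ℝ) < ε := hε2
  exact pos_of_mul_pos_right (by rw [← h1]; simpa using hε) h2

/-- On each side of a face there is at most one tetrahedron. -/
lemma apex_unique {κ : ℝ} (hT : T.IsShapeRegular κ) (hF : F.card = 3)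
    (hn : IsUnitNormal F n) {a b : E3} (haF : a ∉ F) (hbF : b ∉ F) (ha : insert a F ∈ T.tets)
    (hb : insert b F ∈ T.tets) (hha : 0 < height n F a) (hhb : 0 < height n F b) : a = b := by
  by_contra hab
  obtain ⟨lam, hlam⟩ := exists_isBarycentric (T.card_eq _ ha) (T.indep _ ha)
  obtain ⟨mu, hmu⟩ := exists_isBarycentric (T.card_eq _ hb) (T.indep _ hb)
  obtain ⟨z, r, hr, hball, -⟩ := hT _ ha
  obtain ⟨z', r', hr', hball', -⟩ := hT _ hb
  -- A point slightly above the face would belong to both tetrahedra.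
  set ε := min r r' / 3 with hε
  have hε0 : 0 < ε := by positivity
  set x := faceCenter F + ε • n with hx
  have hdist : dist x (faceCenter F) = ε := by
    rw [hx, dist_eq_norm, add_sub_cancel_left, norm_smul, hn.1, Real.norm_of_nonneg hε0.le, mul_one]
  have hheight : height n F x = ε := by
    rw [hx, height_apply, add_sub_cancel_left, inner_smul_right, real_inner_self_eq_norm_sq, hn.1]
    norm_num
  have h1 : x ∈ hull (insert a F) := hlam.mem_hull_of_dist_le hr hball hF haF rfl hn
    (by rw [hdist, hε]; gcongr; exact min_le_left _ _) (by rw [hheight]; positivity)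
  have h2 : x ∈ hull (insert b F) := hmu.mem_hull_of_dist_le hr' hball' hF hbF rfl hn
    (by rw [hdist, hε]; gcongr; exact min_le_right _ _) (by rw [hheight]; positivity)
  have h3 := hlam.apply_eq_zero_of_mem_convexHull (Finset.mem_insert_self a F)
    Set.inter_subset_left (fun h => by
      have := h.2
      simp only [Finset.coe_insert, Set.mem_insert_iff, Finset.mem_coe] at this
      exact this.elim hab haF) (T.conforming _ ha _ hb ⟨h1, h2⟩)
  have h4 := hlam.height_eq hF haF rfl hn x
  rw [h3, zero_mul, hheight] at h4
  exact hε0.ne' h4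

/-- An interior face is shared by exactly two tetrahedra, which lie on different sides of it. -/
lemma exists_two_tets {κ : ℝ} (hT : T.IsShapeRegular κ) (hΩ : IsOpen Ω)
    (hF : F ∈ T.interiorFaces) (hn : IsUnitNormal F n) :
    ∃ a b, a ∉ F ∧ b ∉ F ∧ 0 < height n F a ∧ height n F b < 0 ∧
      ∀ K, K ∈ T.tets ∧ F ⊆ K ↔ K = insert a F ∨ K = insert b F := by
  obtain ⟨a, haF, ha, hha⟩ := T.exists_tet_of_normal hΩ hF hn
  obtain ⟨b, hbF, hb, hhb⟩ := T.exists_tet_of_normal hΩ hF hn.neg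
  have hhb' : height n F b < 0 := by rw [height_neg] at hhb; linarith
  refine ⟨a, b, haF, hbF, hha, hhb', fun K => ⟨fun ⟨hK, hFK⟩ => ?_, ?_⟩⟩
  · obtain ⟨c, hcF, rfl⟩ := exists_apex hF.1 (T.card_eq K hK) hFK
    obtain ⟨lam, hlam⟩ := exists_isBarycentric (T.card_eq _ hK) (T.indep _ hK)
    rcases lt_or_gt_of_ne (hlam.height_apex_ne_zero hF.1 hcF rfl hn) with h | h
    · right
      rw [T.apex_unique hT hF.1 hn.neg hcF hbF hK hb (by rw [height_neg]; linarith) hhb]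
    · left
      rw [T.apex_unique hT hF.1 hn hcF haF hK ha h hha]
  · rintro (rfl | rfl)
    · exact ⟨ha, Finset.subset_insert a F⟩
    · exact ⟨hb, Finset.subset_insert b F⟩

end TetMesh

/-! ### The closure of the domain -/

/-- A Lipschitz domain lies on one side of its boundary. -/
lemma interior_closure_subset {Ω : Set E3} (hΩ : HasLipschitzBoundary Ω) :
    interior (closure Ω) ⊆ Ω := by
  intro x hx
  by_contra hxΩ
  have hfr : x ∈ frontier Ω := ⟨interior_subset hx, fun h => hxΩ (interior_subset h)⟩
  obtain ⟨e, r, L, g, hr, hg, hloc⟩ := hΩ x hfr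
  -- Moving down from `x` leads to points strictly below the graph.
  have hcont : Continuous fun t : ℝ => x - t • e.symm (EuclideanSpace.single 2 1) := by fun_prop
  have h1 : ∀ᶠ t in nhdsWithin (0 : ℝ) (Set.Ioi 0),
      x - t • e.symm (EuclideanSpace.single 2 1) ∈ interior (closure Ω) ∩ Metric.ball x r :=
    nhdsWithin_le_nhds (hcont.continuousAt.preimage_mem_nhds
      ((isOpen_interior.inter Metric.isOpen_ball).mem_nhds (by simpa using ⟨hx, hr⟩)))
  obtain ⟨t, ⟨ht1, ht2⟩, ht0⟩ := (h1.and self_mem_nhdsWithin).exists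
  have ht0' : (0 : ℝ) < t := ht0
  set y := x - t • e.symm (EuclideanSpace.single 2 1) with hy
  have hey : e y = e x - t • EuclideanSpace.single 2 1 := by simp [hy]
  have hgx : e x 2 ≤ g (!₂[e x 0, e x 1]) :=
    not_lt.1 fun h => hxΩ ((hloc x (Metric.mem_ball_self hr)).2 h)
  have hbelow : e y 2 < g (!₂[e y 0, e y 1]) := by
    rw [hey]; simpa using lt_of_lt_of_le (sub_lt_self _ ht0') hgx
  have hecont : ∀ i, Continuous fun w => e w i := fun i =>
    (EuclideanSpace.proj (𝕜 := ℝ) i).continuous.comp e.continuous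
  have hopen : IsOpen ({w | e w 2 < g (!₂[e w 0, e w 1])} ∩ Metric.ball x r) := by
    refine (isOpen_lt (hecont 2) (hg.continuous.comp ?_)).inter Metric.isOpen_ball
    refine (PiLp.continuous_toLp 2 _).comp (continuous_pi fun i => ?_)
    fin_cases i
    · exact hecont 0
    · exact hecont 1
  obtain ⟨w, ⟨hw1, hw2⟩, hwΩ⟩ := mem_closure_iff.1 (interior_subset ht1) _ hopen ⟨hbelow, ht2⟩
  exact lt_asymm hw1 ((hloc w hw2).1 hwΩ)

lemma TetMesh.ae_eq_closure {Ω : Set E3} (hΩ : IsLipschitzDomain Ω) (T : TetMesh Ω) :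
    Ω =ᵐ[volume] closure Ω := by
  have h : volume (frontier Ω) = 0 := by
    refine measure_mono_null (t := ⋃ K ∈ T.tets, frontier (hull K)) (fun x hx => ?_) ?_
    · have h1 : x ∈ closure Ω := hx.1
      rw [T.cover, Set.mem_iUnion₂] at h1
      obtain ⟨K, hK, hxK⟩ := h1
      refine Set.mem_iUnion₂.2 ⟨K, hK, subset_closure hxK, fun hint => hx.2 ?_⟩
      rw [hΩ.isOpen.interior_eq]
      refine interior_closure_subset hΩ.lipschitz (interior_mono ?_ hint)
      rw [T.cover]
      exact Set.subset_iUnion₂ (s := fun K _ => hull K) K hK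
    · exact (measure_biUnion_null_iff T.tets.countable_toSet).2 fun K _ =>
        (convex_convexHull ℝ _).addHaar_frontier volume
  refine (Filter.EventuallyEq.symm ?_)
  refine ae_eq_set.2 ⟨?_, ?_⟩
  · exact by rwa [← hΩ.isOpen.frontier_eq]
  · rw [Set.sdiff_eq_empty.2 subset_closure, measure_empty]

/-! ### Gradients as test fields -/

lemma integral_fderiv_mul_fderiv_comm {ψ g : E3 → ℝ} (hψ : ContDiff ℝ 2 ψ)
    (hψs : HasCompactSupport ψ) (hg : ContDiff ℝ 2 g) (v w : E3) :
    ∫ x, fderiv ℝ ψ x v * fderiv ℝ g x w = ∫ x, fderiv ℝ ψ x w * fderiv ℝ g x v := by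
  have hg' : ∀ w, ContDiff ℝ 1 fun x => fderiv ℝ g x w := fun w =>
    (hg.fderiv_right (m := 1) (by norm_num)).clm_apply contDiff_const
  have key : ∀ v w, ∫ x, fderiv ℝ ψ x v * fderiv ℝ g x w =
      -∫ x, ψ x * fderiv ℝ (fun x => fderiv ℝ g x w) x v := by
    intro v w
    have hcψ : Continuous fun x => fderiv ℝ ψ x v :=
      (hψ.continuous_fderiv (by norm_num)).clm_apply continuous_const
    have hcg : Continuous fun x => fderiv ℝ (fun x => fderiv ℝ g x w) x v :=
      ((hg' w).continuous_fderiv (by norm_num)).clm_apply continuous_const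
    have h := integral_mul_fderiv_eq_neg_fderiv_mul_of_integrable (μ := (volume : Measure E3))
      (f := ψ) (g := fun x => fderiv ℝ g x w) (v := v)
      ((hcψ.mul (hg' w).continuous).integrable_of_hasCompactSupport
        (hψs.fderiv_apply (𝕜 := ℝ) v).mul_right)
      ((hψ.continuous.mul hcg).integrable_of_hasCompactSupport hψs.mul_right)
      ((hψ.continuous.mul (hg' w).continuous).integrable_of_hasCompactSupport hψs.mul_right)
      (fun x _ => hψ.differentiable (by norm_num) x)
      (fun x _ => (hg' w).differentiable (by norm_num) x)
    rw [h, neg_neg]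
  rw [key v w, key w v]
  congr 2
  funext x
  have hd : DifferentiableAt ℝ (fderiv ℝ g) x :=
    (hg.fderiv_right (m := 1) (by norm_num)).differentiable (by norm_num) x
  have h1 : ∀ v w, fderiv ℝ (fun x => fderiv ℝ g x w) x v = fderiv ℝ (fderiv ℝ g) x v w := by
    intro v w
    rw [fderiv_clm_apply hd (differentiableAt_const w)]
    simp
  rw [h1, h1, (hg.contDiffAt.isSymmSndFDerivAt (by simp)) v w]

lemma partialD_eq {φ : E3 → E3} (hφ : ContDiff ℝ ∞ φ) (j i : Fin 3) (x : E3) :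
    partialD φ j i x = fderiv ℝ (fun y => φ y i) x (EuclideanSpace.single j 1) := by
  have h1 : HasFDerivAt φ (fderiv ℝ φ x) x := (hφ.differentiable (by simp) x).hasFDerivAt
  have h2 := ((EuclideanSpace.proj i : E3 →L[ℝ] ℝ).hasFDerivAt (x := φ x)).comp x h1
  have h3 : fderiv ℝ (fun y => φ y i) x =
      (EuclideanSpace.proj i : E3 →L[ℝ] ℝ).comp (fderiv ℝ φ x) :=
    h2.fderiv
  rw [h3, partialD]
  rfl

lemma integral_inner_gradient_curl {ψ : E3 → ℝ} (hψ : ContDiff ℝ ∞ ψ) (hψs : HasCompactSupport ψ)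
    {φ : E3 → E3} (hφ : ContDiff ℝ ∞ φ) : ∫ x, inner ℝ (gradient ψ x) (curl φ x) = 0 := by
  have hφi : ∀ i, ContDiff ℝ ∞ fun x => φ x i := fun i =>
    (EuclideanSpace.proj (𝕜 := ℝ) i).contDiff.comp hφ
  set J : Fin 3 → Fin 3 → Fin 3 → E3 → ℝ := fun i j l x =>
    fderiv ℝ ψ x (EuclideanSpace.single i 1) *
      fderiv ℝ (fun y => φ y l) x (EuclideanSpace.single j 1) with hJ
  have hint : ∀ i j l, Integrable (J i j l) := fun i j l =>
    (((hψ.continuous_fderiv (by simp)).clm_apply continuous_const).mul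
      (((hφi l).continuous_fderiv (by simp)).clm_apply
        continuous_const)).integrable_of_hasCompactSupport
      (hψs.fderiv_apply (𝕜 := ℝ) _).mul_right
  have hcomm : ∀ i j l, ∫ x, J i j l x = ∫ x, J j i l x := fun i j l =>
    integral_fderiv_mul_fderiv_comm (by exact_mod_cast contDiff_infty.1 hψ 2) hψs
      (by exact_mod_cast contDiff_infty.1 (hφi l) 2) _ _
  set Q : Fin 3 → Fin 3 → Fin 3 → E3 → ℝ := fun i j l x => J i j l x - J j i l x with hQ
  have hQint : ∀ i j l, Integrable (Q i j l) := fun i j l => (hint i j l).sub (hint j i l)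
  have hQ0 : ∀ i j l, ∫ x, Q i j l x = 0 := fun i j l => by
    rw [hQ, integral_sub (hint i j l) (hint j i l), hcomm, sub_self]
  have hpt : ∀ x, inner ℝ (gradient ψ x) (curl φ x) =
      Q 0 1 2 x + Q 1 2 0 x + Q 2 0 1 x := by
    intro x
    have hc : curl φ x = ∑ i, curl φ x i • EuclideanSpace.single i (1 : ℝ) := by
      ext i; simp [Finset.sum_apply, Pi.single_apply]
    rw [real_inner_comm, inner_gradient, hc, map_sum, Fin.sum_univ_three]
    simp only [curl, map_smul, smul_eq_mul, hQ, hJ, partialD_eq hφ]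
    simp
    ring
  simp_rw [hpt]
  refine (integral_add ((hQint 0 1 2).add (hQint 1 2 0)) (hQint 2 0 1)).trans ?_
  rw [integral_add' (hQint 0 1 2) (hQint 1 2 0), hQ0, hQ0, hQ0]
  simp

lemma gradient_eq_zero_of_notMem {ψ : E3 → ℝ} {S : Set E3} (hS : tsupport ψ ⊆ S) {x : E3}
    (hx : x ∉ S) : gradient ψ x = 0 := by
  have h : fderiv ℝ ψ x = 0 :=
    Function.notMem_support.1 fun h => hx (hS (support_fderiv_subset ℝ h))
  rw [gradient, h, map_zero]

lemma memLp_gradient {ψ : E3 → ℝ} (hψ : ContDiff ℝ 1 ψ) (hψs : HasCompactSupport ψ) :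
    MemLp (gradient ψ) 2 :=
  (continuous_gradient hψ).memLp_of_hasCompactSupport (hasCompactSupport_gradient hψs)

lemma isWeakCurl_gradient {Ω : Set E3} {ψ : E3 → ℝ} (hψ : ContDiff ℝ ∞ ψ)
    (hψs : HasCompactSupport ψ) (hsub : tsupport ψ ⊆ Ω) :
    IsWeakCurl Ω (gradient ψ) 0 ∧ HasZeroTangentialTrace Ω (gradient ψ) 0 := by
  have h : ∀ φ : E3 → E3, ContDiff ℝ ∞ φ →
      ∫ x in Ω, inner ℝ ((0 : E3 → E3) x) (φ x) = ∫ x in Ω, inner ℝ (gradient ψ x) (curl φ x) := by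
    intro φ hφ
    have h0 : ∫ x in Ω, inner ℝ (gradient ψ x) (curl φ x) =
        ∫ x, inner ℝ (gradient ψ x) (curl φ x) :=
      setIntegral_eq_integral_of_forall_compl_eq_zero fun x hx => by
        rw [gradient_eq_zero_of_notMem hsub hx, inner_zero_left]
    rw [h0, integral_inner_gradient_curl hψ hψs hφ]
    simp
  exact ⟨⟨(memLp_gradient (hψ.of_le (by exact_mod_cast le_top)) hψs).restrict Ω, MemLp.zero,
    fun φ hφ _ _ => h φ hφ⟩, fun φ hφ _ => h φ hφ⟩

/-- The field `u` of an eigensolution is divergence free. -/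
lemma IsMixedEigensolution.setIntegral_inner_gradient {Ω : Set E3} {lam : ℝ} {u σ : E3 → E3}
    (h : IsMixedEigensolution Ω (H0curl Ω) lam u σ) {ψ : E3 → ℝ} (hψ : ContDiff ℝ ∞ ψ)
    (hψs : HasCompactSupport ψ) {S : Set E3} (hψS : tsupport ψ ⊆ S) (hψΩ : tsupport ψ ⊆ Ω) :
    ∫ x in S, inner ℝ (u x) (gradient ψ x) = 0 := by
  obtain ⟨h1, h2⟩ := isWeakCurl_gradient hψ hψs hψΩ
  have h3 := h.eq_left (gradient ψ) ⟨0, h1, h2⟩ 0 h1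
  have h4 : ∀ S : Set E3, tsupport ψ ⊆ S →
      ∫ x in S, inner ℝ (u x) (gradient ψ x) = ∫ x, inner ℝ (u x) (gradient ψ x) := fun S hS =>
    setIntegral_eq_integral_of_forall_compl_eq_zero fun x hx => by
      rw [gradient_eq_zero_of_notMem hS hx, inner_zero_right]
  rw [h4 S hψS, ← h4 Ω hψΩ]
  simpa using h3

lemma abs_setIntegral_inner_le {w v : E3 → E3} {S : Set E3} (hw : MemLp w 2 (volume.restrict S))
    (hv : MemLp v 2) :
    |∫ x in S, inner ℝ (w x) (v x)| ≤ l2Norm volume S w * Real.sqrt (∫ x, ‖v x‖ ^ 2) := by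
  rw [← Real.norm_eq_abs]
  refine (norm_integral_le_integral_norm _).trans ?_
  have hv' := hv.restrict S
  refine (integral_mono_of_nonneg (Filter.Eventually.of_forall fun x => norm_nonneg _)
    (integrable_norm_mul_norm hw hv')
    (Filter.Eventually.of_forall fun x => norm_inner_le_norm _ _)).trans ?_
  refine (integral_norm_mul_norm_le hw hv').trans ?_
  rw [l2Norm]
  gcongr
  · exact Filter.Eventually.of_forall fun x => by positivity
  · exact (memLp_two_iff_integrable_sq_norm hv.1).1 hv
  · exact Measure.restrict_le_self

/-! ### Similarities -/

/-- The similarity `x ↦ ρ⁻¹ e (x - z)`, which takes the ball of radius `ρ` around `z` to the unit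
ball. -/
noncomputable def similarity (e : E3 ≃ₗᵢ[ℝ] E3) (z : E3) (ρ : ℝ) (x : E3) : E3 := ρ⁻¹ • e (x - z)

section Similarity

variable (e : E3 ≃ₗᵢ[ℝ] E3) (z : E3) {ρ : ℝ}

lemma norm_similarity (hρ : 0 < ρ) (x : E3) : ‖similarity e z ρ x‖ = ρ⁻¹ * dist x z := by
  rw [similarity, norm_smul, e.norm_map, dist_eq_norm, Real.norm_of_nonneg (by positivity)]

lemma integral_comp_similarity (hρ : 0 < ρ) (f : E3 → ℝ) :
    ∫ x, f (similarity e z ρ x) = ρ ^ 3 * ∫ y, f y := by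
  have h1 := (measurePreserving_rigid e z).integral_comp' (fun y => f (ρ⁻¹ • y))
  have h2 := Measure.integral_comp_inv_smul_of_nonneg (volume : Measure E3) f hρ.le
  simp only [finrank_euclideanSpace, Fintype.card_fin, smul_eq_mul] at h2
  exact h1.trans h2

lemma hasFDerivAt_similarity (x : E3) : HasFDerivAt (similarity e z ρ)
    (ρ⁻¹ • (e.toContinuousLinearEquiv : E3 →L[ℝ] E3)) x := by
  have h1 : HasFDerivAt (𝕜 := ℝ) e (e.toContinuousLinearEquiv : E3 →L[ℝ] E3) (x - z) :=
    e.toContinuousLinearEquiv.hasFDerivAt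
  have h2 : HasFDerivAt (𝕜 := ℝ) (fun x : E3 => x - z) (ContinuousLinearMap.id ℝ E3) x :=
    (hasFDerivAt_id x).sub_const z
  have h := (h1.comp x h2).const_smul ρ⁻¹
  rw [ContinuousLinearMap.comp_id] at h
  exact h

lemma contDiff_similarity {n : WithTop ℕ∞} : ContDiff ℝ n (similarity e z ρ) :=
  contDiff_const.smul (f := fun _ => ρ⁻¹) (g := fun x => e (x - z))
    (e.contDiff.comp (contDiff_id.sub contDiff_const))

lemma norm_gradient_comp_similarity (hρ : 0 < ρ) {G : E3 → ℝ} (hG : ContDiff ℝ 1 G) (x : E3) :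
    ‖gradient (fun x => G (similarity e z ρ x)) x‖ = ρ⁻¹ * ‖fderiv ℝ G (similarity e z ρ x)‖ := by
  have h := ((hG.differentiable (by norm_num) _).hasFDerivAt.comp x
    (hasFDerivAt_similarity e z (ρ := ρ) x)).fderiv
  have h' : fderiv ℝ (fun x => G (similarity e z ρ x)) x = _ := h
  rw [norm_gradient, h', ContinuousLinearMap.comp_smul, norm_smul,
    Real.norm_of_nonneg (by positivity)]
  congr 1
  exact ContinuousLinearMap.opNorm_comp_linearIsometryEquiv _ e

lemma sqrt_integral_norm_gradient (hρ : 0 < ρ) {G : E3 → ℝ} (hG : ContDiff ℝ 1 G) :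
    Real.sqrt (∫ x, ‖gradient (fun x => G (similarity e z ρ x)) x‖ ^ 2) =
      Real.sqrt ρ * Real.sqrt (∫ y, ‖fderiv ℝ G y‖ ^ 2) := by
  simp_rw [norm_gradient_comp_similarity e z hρ hG, mul_pow]
  rw [integral_const_mul, integral_comp_similarity e z hρ fun y => ‖fderiv ℝ G y‖ ^ 2,
    ← Real.sqrt_mul hρ.le]
  congr 1
  field_simp

lemma tsupport_comp_similarity_subset (hρ : 0 < ρ) {G : E3 → ℝ} {s : ℝ}
    (hG : ∀ y, G y ≠ 0 → ‖y‖ ≤ s) :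
    tsupport (fun x => G (similarity e z ρ x)) ⊆ Metric.closedBall z (ρ * s) := by
  refine closure_minimal (fun x hx => ?_) Metric.isClosed_closedBall
  have h := hG _ hx
  rw [norm_similarity e z hρ] at h
  rw [Metric.mem_closedBall]
  calc dist x z = ρ * (ρ⁻¹ * dist x z) := by field_simp
    _ ≤ ρ * s := by gcongr

lemma hasCompactSupport_comp_similarity (hρ : 0 < ρ) {G : E3 → ℝ} {s : ℝ}
    (hG : ∀ y, G y ≠ 0 → ‖y‖ ≤ s) : HasCompactSupport fun x => G (similarity e z ρ x) :=
  (isCompact_closedBall z (ρ * s)).of_isClosed_subset (isClosed_tsupport _)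
    (tsupport_comp_similarity_subset e z hρ hG)

end Similarity

/-! ### The bound for the divergence -/

/-- A smooth cut-off function that is `1` near the ball of radius `1 / 2` and vanishes outside the
ball of radius `3 / 4`. -/
noncomputable def cutoff : ContDiffBump (0 : E3) := ⟨1 / 2, 3 / 4, by norm_num, by norm_num⟩

lemma cutoff_eq_one {y : E3} (hy : ‖y‖ ≤ 1 / 2) : cutoff y = 1 :=
  cutoff.one_of_mem_closedBall (by simpa [cutoff] using hy)

lemma norm_le_of_cutoff_ne_zero {y : E3} (hy : cutoff y ≠ 0) : ‖y‖ ≤ 3 / 4 := by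
  by_contra! h
  exact hy (cutoff.zero_of_le_dist (by simpa [cutoff] using h.le))

lemma contDiff_cutoff {n : ℕ∞} : ContDiff ℝ n cutoff := cutoff.contDiff

lemma hasCompactSupport_cutoff_mul (f : E3 → ℝ) : HasCompactSupport fun y => cutoff y * f y :=
  cutoff.hasCompactSupport.mul_right

lemma memLp_restrict_of_isBounded {E : Type*} [NormedAddCommGroup E] [NormedSpace ℝ E]
    [FiniteDimensional ℝ E] [MeasureSpace E] [BorelSpace E]
    [IsFiniteMeasureOnCompacts (volume : Measure E)] {f : E → ℝ}
    (hf : Continuous f) {S : Set E} (hS : Bornology.IsBounded S) :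
    MemLp f 2 (volume.restrict S) := by
  have hc : IsCompact (closure S) := hS.isCompact_closure
  have : Fact (volume (closure S) < ⊤) := ⟨hc.measure_lt_top⟩
  obtain ⟨C, hC⟩ := hc.exists_bound_of_continuousOn hf.continuousOn
  have h : MemLp f 2 (volume.restrict (closure S)) :=
    MemLp.of_bound hf.aestronglyMeasurable C
      ((ae_restrict_iff' isClosed_closure.measurableSet).2 (Filter.Eventually.of_forall hC))
  exact h.mono_measure (Measure.restrict_mono subset_closure le_rfl)

/-- A polynomial function is determined by its restriction to a ball, up to null sets. -/
lemma eq_zero_of_ae_eq_zero_on_ball {ι : Type*} [Fintype ι] {d : ℕ} {f : EuclideanSpace ℝ ι → ℝ}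
    (hf : f ∈ polyFun ι d) {δ : ℝ} (hδ : 0 < δ)
    (h : f =ᵐ[volume.restrict (Metric.ball 0 δ)] 0) : f = 0 := by
  refine eq_zero_of_mem_polyFun hf hδ fun x hx => ?_
  exact Measure.eqOn_open_of_ae_eq h Metric.isOpen_ball
    (contDiff_of_mem_polyFun hf (n := 0)).continuous.continuousOn continuousOn_const hx

lemma exists_sqrt_integral_polyFun_le {ι : Type*} [Fintype ι] (d : ℕ) {α X : Type*}
    [MeasurableSpace α] {μ : Measure α} [NormedAddCommGroup X] [NormedSpace ℝ X]
    (A : polyFun ι d →ₗ[ℝ] α → X) (hA : ∀ f, MemLp (A f) 2 μ) :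
    ∃ C : ℝ, 0 < C ∧ ∀ f, Real.sqrt (∫ x, ‖A f x‖ ^ 2 ∂μ) ≤
      C * Real.sqrt (∫ y in Metric.ball (0 : EuclideanSpace ℝ ι) (1 / 2), f.1 y ^ 2) := by
  obtain ⟨C, hC, h⟩ := exists_sqrt_integral_le
    (ν := volume.restrict (Metric.ball (0 : EuclideanSpace ℝ ι) (1 / 2))) A
    (polyFun ι d).subtype hA
    (fun f => memLp_restrict_of_isBounded (contDiff_of_mem_polyFun f.2 (n := 0)).continuous
      Metric.isBounded_ball)
    (fun f hf => Subtype.ext (eq_zero_of_ae_eq_zero_on_ball f.2 (by norm_num) hf))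
  exact ⟨C, hC, fun f => by simpa using h f⟩

/-- The inverse estimates for polynomials on the reference ball. -/
lemma exists_inverse_estimate (d : ℕ) (R : ℝ) : ∃ C : ℝ, 0 < C ∧ ∀ f ∈ polyFun (Fin 3) d,
    Real.sqrt (∫ y, ‖fderiv ℝ (fun y => cutoff y * f y) y‖ ^ 2) ≤
        C * Real.sqrt (∫ y in Metric.ball (0 : E3) (1 / 2), f y ^ 2) ∧
      Real.sqrt (∫ y in Metric.closedBall (0 : E3) R, f y ^ 2) ≤
        C * Real.sqrt (∫ y in Metric.ball (0 : E3) (1 / 2), f y ^ 2) := by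
  have hcd : ∀ f : polyFun (Fin 3) d, ContDiff ℝ 1 fun y => cutoff y * f.1 y := fun f =>
    (contDiff_cutoff (n := 1)).mul (contDiff_of_mem_polyFun f.2)
  have hdiff : ∀ (f : polyFun (Fin 3) d) y, DifferentiableAt ℝ (fun y => cutoff y * f.1 y) y :=
    fun f y => (hcd f).differentiable (by norm_num) y
  obtain ⟨C₁, hC₁, h₁⟩ := exists_sqrt_integral_polyFun_le d (μ := (volume : Measure E3))
    { toFun := fun f => fderiv ℝ (fun y => cutoff y * f.1 y)
      map_add' := fun f g => by
        funext y
        rw [Pi.add_apply, ← fderiv_fun_add (hdiff f y) (hdiff g y)]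
        congr 1; funext y; simp [mul_add]
      map_smul' := fun c f => by
        funext y
        rw [RingHom.id_apply, Pi.smul_apply, ← fderiv_fun_const_smul (hdiff f y)]
        congr 1; funext y; simp [mul_left_comm] }
    (fun f => ((hcd f).continuous_fderiv (by norm_num)).memLp_of_hasCompactSupport
      ((hasCompactSupport_cutoff_mul f.1).fderiv (𝕜 := ℝ)))
  obtain ⟨C₂, hC₂, h₂⟩ := exists_sqrt_integral_polyFun_le d
    (μ := volume.restrict (Metric.closedBall (0 : E3) R)) (polyFun (Fin 3) d).subtype
    (fun f => memLp_restrict_of_isBounded (contDiff_of_mem_polyFun f.2 (n := 0)).continuous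
      Metric.isBounded_closedBall)
  refine ⟨max C₁ C₂, lt_max_of_lt_left hC₁, fun f hf => ⟨?_, ?_⟩⟩
  · exact (h₁ ⟨f, hf⟩).trans (by gcongr; exact le_max_left _ _)
  · have := h₂ ⟨f, hf⟩
    simp only [Submodule.subtype_apply, Real.norm_eq_abs, sq_abs] at this
    exact this.trans (by gcongr; exact le_max_right _ _)

/-- A polynomial whose products with test functions are controlled by the gradients of the latter is
small: the polynomial times a cut-off function is itself a test function. -/
lemma exists_ball_bound (d : ℕ) (R : ℝ) : ∃ C : ℝ, 0 < C ∧
    ∀ (z : E3) (ρ : ℝ), 0 < ρ → ∀ q ∈ polyFun (Fin 3) d, ∀ E : ℝ, 0 ≤ E →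
    (∀ ψ : E3 → ℝ, ContDiff ℝ ∞ ψ → HasCompactSupport ψ → tsupport ψ ⊆ Metric.ball z ρ →
      |∫ x, q x * ψ x| ≤ E * Real.sqrt (∫ x, ‖gradient ψ x‖ ^ 2)) →
    ρ * Real.sqrt (∫ x in Metric.closedBall z (R * ρ), q x ^ 2) ≤ C * E := by
  obtain ⟨C, hC, h⟩ := exists_inverse_estimate d R
  refine ⟨C * C, by positivity, fun z ρ hρ q hq E hE hqE => ?_⟩
  set e : E3 ≃ₗᵢ[ℝ] E3 := LinearIsometryEquiv.refl ℝ E3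
  -- `f` is `q` in the coordinates of the reference ball, `G` the test function there.
  set f : E3 → ℝ := fun y => q (z + ρ • y) with hf_def
  have hf : f ∈ polyFun (Fin 3) d := comp_mem_polyFun hq fun i => by
    simpa using affine_mem_polyFun (ρ • (EuclideanSpace.proj i : E3 →L[ℝ] ℝ).toLinearMap) (z i)
  have hfq : ∀ x, f (similarity e z ρ x) = q x := fun x => by
    simp [hf_def, similarity, e, smul_smul, hρ.ne']
  obtain ⟨h1, h2⟩ := h f hf
  set N := Real.sqrt (∫ y in Metric.ball (0 : E3) (1 / 2), f y ^ 2) with hN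
  have hN0 : 0 ≤ N := Real.sqrt_nonneg _
  have hfc : Continuous f := (contDiff_of_mem_polyFun hf (n := 0)).continuous
  set G : E3 → ℝ := fun y => cutoff y * f y with hG_def
  have hG : ContDiff ℝ ∞ G := contDiff_cutoff.mul (contDiff_of_mem_polyFun hf)
  have hGs : ∀ y, G y ≠ 0 → ‖y‖ ≤ 3 / 4 := fun y hy =>
    norm_le_of_cutoff_ne_zero (left_ne_zero_of_mul hy)
  have hbound := hqE (fun x => G (similarity e z ρ x)) (hG.comp (contDiff_similarity e z))
    (hasCompactSupport_comp_similarity e z hρ hGs)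
    ((tsupport_comp_similarity_subset e z hρ hGs).trans
      (Metric.closedBall_subset_ball (by linarith)))
  rw [sqrt_integral_norm_gradient e z hρ (hG.of_le (by exact_mod_cast le_top))] at hbound
  have hlow : ρ ^ 3 * N ^ 2 ≤ ∫ x, q x * G (similarity e z ρ x) := by
    have e1 : ∫ x, q x * G (similarity e z ρ x) = ρ ^ 3 * ∫ y, f y * G y := by
      rw [← integral_comp_similarity e z hρ fun y => f y * G y]
      simp_rw [hfq]
    rw [e1, hN, Real.sq_sqrt (integral_nonneg fun _ => sq_nonneg _)]
    gcongr
    rw [← integral_indicator measurableSet_ball]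
    refine integral_mono_of_nonneg (Filter.Eventually.of_forall fun y =>
      Set.indicator_nonneg (fun _ _ => sq_nonneg _) y) ?_ (Filter.Eventually.of_forall fun y => ?_)
    · exact (hfc.mul hG.continuous).integrable_of_hasCompactSupport
        (hasCompactSupport_cutoff_mul f).mul_left
    · by_cases hy : y ∈ Metric.ball (0 : E3) (1 / 2)
      · rw [Set.indicator_of_mem hy]
        rw [mem_ball_zero_iff] at hy
        simp [hG_def, cutoff_eq_one hy.le, sq]
      · rw [Set.indicator_of_notMem hy]
        change 0 ≤ f y * (cutoff y * f y)
        have := mul_nonneg cutoff.nonneg (mul_self_nonneg (f y)) (a := cutoff y)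
        linarith
  have hup : Real.sqrt (∫ x in Metric.closedBall z (R * ρ), q x ^ 2) ≤
      Real.sqrt (ρ ^ 3) * (C * N) := by
    refine le_trans (le_of_eq ?_) (mul_le_mul_of_nonneg_left h2 (Real.sqrt_nonneg _))
    rw [← Real.sqrt_mul (by positivity),
      ← integral_indicator Metric.isClosed_closedBall.measurableSet,
      ← integral_indicator Metric.isClosed_closedBall.measurableSet,
      ← integral_comp_similarity e z hρ]
    congr 2
    funext x
    have hiff : x ∈ Metric.closedBall z (R * ρ) ↔
        similarity e z ρ x ∈ Metric.closedBall (0 : E3) R := by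
      rw [mem_closedBall_zero_iff, norm_similarity e z hρ, Metric.mem_closedBall, mul_comm ρ⁻¹,
        ← div_eq_mul_inv, div_le_iff₀ hρ]
    by_cases hx : x ∈ Metric.closedBall z (R * ρ)
    · rw [Set.indicator_of_mem hx, Set.indicator_of_mem (hiff.1 hx), hfq]
    · rw [Set.indicator_of_notMem hx, Set.indicator_of_notMem (mt hiff.2 hx)]
  -- In terms of `t = √ρ` all powers of `ρ` become integral.
  set t := Real.sqrt ρ with ht
  have ht0 : 0 < t := Real.sqrt_pos.2 hρ
  have htρ : ρ = t ^ 2 := (Real.sq_sqrt hρ.le).symm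
  have ht3 : Real.sqrt (ρ ^ 3) = t ^ 3 := by
    rw [htρ, ← pow_mul, mul_comm, pow_mul, Real.sqrt_sq (by positivity)]
  rw [ht3] at hup
  have hmain : t ^ 6 * N ^ 2 ≤ E * (t * (C * N)) := by
    calc t ^ 6 * N ^ 2 = ρ ^ 3 * N ^ 2 := by rw [htρ]; ring
      _ ≤ _ := hlow.trans ((le_abs_self _).trans hbound)
      _ ≤ _ := by gcongr
  have hN' : t ^ 5 * N ≤ C * E := by
    rcases hN0.eq_or_lt with h0 | h0
    · rw [← h0, mul_zero]; positivity
    · refine le_of_mul_le_mul_right ?_ (mul_pos ht0 h0)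
      linarith
  calc ρ * Real.sqrt (∫ x in Metric.closedBall z (R * ρ), q x ^ 2) ≤ ρ * (t ^ 3 * (C * N)) := by
        gcongr
    _ = C * (t ^ 5 * N) := by rw [htρ]; ring
    _ ≤ C * (C * E) := by gcongr
    _ = C * C * E := by ring

/-! ### The bound for the jumps -/

/-- The orthogonal projection to the coordinate plane. -/
noncomputable def planeProj (y : E3) : EuclideanSpace ℝ (Fin 2) := !₂[y 0, y 1]

lemma planeProj_planeEmb (s : EuclideanSpace ℝ (Fin 2)) : planeProj (planeEmb s) = s := by
  ext i; fin_cases i <;> simp [planeProj, planeEmb_apply]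

lemma planeEmb_planeProj {y : E3} (hy : y 2 = 0) : planeEmb (planeProj y) = y := by
  ext i; fin_cases i <;> simp [planeProj, planeEmb_apply, hy]

lemma comp_planeProj_mem_polyFun {d : ℕ} {f : EuclideanSpace ℝ (Fin 2) → ℝ}
    (hf : f ∈ polyFun (Fin 2) d) : (fun y => f (planeProj y)) ∈ polyFun (Fin 3) d :=
  comp_mem_polyFun hf fun i => by
    fin_cases i
    · simpa [planeProj] using affine_mem_polyFun (EuclideanSpace.proj 0 : E3 →L[ℝ] ℝ).toLinearMap 0
    · simpa [planeProj] using affine_mem_polyFun (EuclideanSpace.proj 1 : E3 →L[ℝ] ℝ).toLinearMap 0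

/-- The parametrization by `ℝ²` of the plane through `z` that `e` makes horizontal. -/
noncomputable def planeMap (e : E3 ≃ₗᵢ[ℝ] E3) (z : E3) (s : EuclideanSpace ℝ (Fin 2)) : E3 :=
  z + e.symm (planeEmb s)

lemma isometry_planeMap (e : E3 ≃ₗᵢ[ℝ] E3) (z : E3) : Isometry (planeMap e z) :=
  (isometry_add_left z).comp (e.symm.isometry.comp planeEmb.isometry)

lemma similarity_planeMap (e : E3 ≃ₗᵢ[ℝ] E3) (z : E3) (ρ : ℝ) (s : EuclideanSpace ℝ (Fin 2)) :
    similarity e z ρ (planeMap e z s) = planeEmb (ρ⁻¹ • s) := by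
  simp [similarity, planeMap]

/-- The inverse estimates for polynomials on the reference disk, extended to space by a constant in
the normal direction. -/
lemma exists_inverse_estimate_plane (d : ℕ) (R : ℝ) : ∃ C : ℝ, 0 < C ∧ ∀ f ∈ polyFun (Fin 2) d,
    Real.sqrt (∫ y, ‖fderiv ℝ (fun y => cutoff y * f (planeProj y)) y‖ ^ 2) ≤
        C * Real.sqrt (∫ s in Metric.ball (0 : EuclideanSpace ℝ (Fin 2)) (1 / 2), f s ^ 2) ∧
      Real.sqrt (∫ y, ‖cutoff y * f (planeProj y)‖ ^ 2) ≤
        C * Real.sqrt (∫ s in Metric.ball (0 : EuclideanSpace ℝ (Fin 2)) (1 / 2), f s ^ 2) ∧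
      Real.sqrt (∫ s in Metric.closedBall (0 : EuclideanSpace ℝ (Fin 2)) R, f s ^ 2) ≤
        C * Real.sqrt (∫ s in Metric.ball (0 : EuclideanSpace ℝ (Fin 2)) (1 / 2), f s ^ 2) := by
  have hcd : ∀ f : polyFun (Fin 2) d, ContDiff ℝ 1 fun y => cutoff y * f.1 (planeProj y) :=
    fun f => (contDiff_cutoff (n := 1)).mul
      (contDiff_of_mem_polyFun (comp_planeProj_mem_polyFun f.2))
  have hdiff : ∀ (f : polyFun (Fin 2) d) y,
      DifferentiableAt ℝ (fun y => cutoff y * f.1 (planeProj y)) y :=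
    fun f y => (hcd f).differentiable (by norm_num) y
  obtain ⟨C₁, hC₁, h₁⟩ := exists_sqrt_integral_polyFun_le d (μ := (volume : Measure E3))
    { toFun := fun f => fderiv ℝ (fun y => cutoff y * f.1 (planeProj y))
      map_add' := fun f g => by
        funext y
        rw [Pi.add_apply, ← fderiv_fun_add (hdiff f y) (hdiff g y)]
        congr 1; funext y; simp [mul_add]
      map_smul' := fun c f => by
        funext y
        rw [RingHom.id_apply, Pi.smul_apply, ← fderiv_fun_const_smul (hdiff f y)]
        congr 1; funext y; simp [mul_left_comm] }
    (fun f => ((hcd f).continuous_fderiv (by norm_num)).memLp_of_hasCompactSupport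
      ((hasCompactSupport_cutoff_mul fun y => f.1 (planeProj y)).fderiv (𝕜 := ℝ)))
  obtain ⟨C₂, hC₂, h₂⟩ := exists_sqrt_integral_polyFun_le d (μ := (volume : Measure E3))
    { toFun := fun f y => cutoff y * f.1 (planeProj y)
      map_add' := fun f g => by funext y; simp [mul_add]
      map_smul' := fun c f => by funext y; simp [mul_left_comm] }
    (fun f => (hcd f).continuous.memLp_of_hasCompactSupport
      (hasCompactSupport_cutoff_mul fun y => f.1 (planeProj y)))
  obtain ⟨C₃, hC₃, h₃⟩ := exists_sqrt_integral_polyFun_le d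
    (μ := volume.restrict (Metric.closedBall (0 : EuclideanSpace ℝ (Fin 2)) R))
    (polyFun (Fin 2) d).subtype
    (fun f => memLp_restrict_of_isBounded (contDiff_of_mem_polyFun f.2 (n := 0)).continuous
      Metric.isBounded_closedBall)
  refine ⟨max C₁ (max C₂ C₃), lt_max_of_lt_left hC₁, fun f hf => ⟨?_, ?_, ?_⟩⟩
  · exact (h₁ ⟨f, hf⟩).trans (by gcongr; exact le_max_left _ _)
  · exact (h₂ ⟨f, hf⟩).trans (by gcongr; exact (le_max_left _ _).trans (le_max_right _ _))
  · have := h₃ ⟨f, hf⟩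
    simp only [Submodule.subtype_apply, Real.norm_eq_abs, sq_abs] at this
    exact this.trans (by gcongr; exact (le_max_right _ _).trans (le_max_right _ _))

lemma integral_comp_inv_smul_plane {ρ : ℝ} (hρ : 0 < ρ) (f : EuclideanSpace ℝ (Fin 2) → ℝ) :
    ∫ s, f (ρ⁻¹ • s) = ρ ^ 2 * ∫ s, f s := by
  have h2 := Measure.integral_comp_inv_smul_of_nonneg
    (volume : Measure (EuclideanSpace ℝ (Fin 2))) f hρ.le
  simpa only [finrank_euclideanSpace, Fintype.card_fin, smul_eq_mul] using h2

/-- A polynomial on a plane is small if its products with the traces of test functions are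
controlled by the test functions: the polynomial, extended to space by a constant in the normal
direction, times a cut-off function is itself a test function. -/
lemma exists_trace_bound (d : ℕ) (R : ℝ) : ∃ C : ℝ, 0 < C ∧
    ∀ (e : E3 ≃ₗᵢ[ℝ] E3) (z : E3) (ρ : ℝ), 0 < ρ → ∀ J ∈ polyFun (Fin 3) d, ∀ E : ℝ, 0 ≤ E →
    (∀ ψ : E3 → ℝ, ContDiff ℝ ∞ ψ → HasCompactSupport ψ → tsupport ψ ⊆ Metric.ball z ρ →
      |∫ s, J (planeMap e z s) * ψ (planeMap e z s)| ≤
        E * (Real.sqrt (∫ x, ‖gradient ψ x‖ ^ 2) + ρ⁻¹ * Real.sqrt (∫ x, ‖ψ x‖ ^ 2))) →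
    Real.sqrt ρ * Real.sqrt (∫ s in Metric.closedBall 0 (R * ρ), J (planeMap e z s) ^ 2) ≤
      C * E := by
  obtain ⟨C, hC, h⟩ := exists_inverse_estimate_plane d R
  refine ⟨2 * C * C, by positivity, fun e z ρ hρ J hJ E hE hJE => ?_⟩
  -- `f` is `J` in the coordinates of the reference disk, `G` the test function of the unit ball.
  set f : EuclideanSpace ℝ (Fin 2) → ℝ := fun s => J (planeMap e z (ρ • s)) with hf_def
  have hf : f ∈ polyFun (Fin 2) d := comp_mem_polyFun hJ fun i => by
    have := affine_mem_polyFun (ρ • (EuclideanSpace.proj i : E3 →L[ℝ] ℝ).toLinearMap ∘ₗ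
      (e.symm.toLinearEquiv.toLinearMap ∘ₗ planeEmb.toLinearMap)) (z i)
    simpa [planeMap] using this
  have hfJ : ∀ s, f (ρ⁻¹ • s) = J (planeMap e z s) := fun s => by
    simp [hf_def, smul_smul, hρ.ne']
  obtain ⟨h1, h2, h3⟩ := h f hf
  set N := Real.sqrt (∫ s in Metric.ball (0 : EuclideanSpace ℝ (Fin 2)) (1 / 2), f s ^ 2) with hN
  have hN0 : 0 ≤ N := Real.sqrt_nonneg _
  have hfc : Continuous f := (contDiff_of_mem_polyFun hf (n := 0)).continuous
  set G : E3 → ℝ := fun y => cutoff y * f (planeProj y) with hG_def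
  have hG : ContDiff ℝ ∞ G :=
    contDiff_cutoff.mul (contDiff_of_mem_polyFun (comp_planeProj_mem_polyFun hf))
  have hGs : ∀ y, G y ≠ 0 → ‖y‖ ≤ 3 / 4 := fun y hy =>
    norm_le_of_cutoff_ne_zero (left_ne_zero_of_mul hy)
  have hbound := hJE (fun x => G (similarity e z ρ x)) (hG.comp (contDiff_similarity e z))
    (hasCompactSupport_comp_similarity e z hρ hGs)
    ((tsupport_comp_similarity_subset e z hρ hGs).trans
      (Metric.closedBall_subset_ball (by linarith)))
  rw [sqrt_integral_norm_gradient e z hρ (hG.of_le (by exact_mod_cast le_top)),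
    integral_comp_similarity e z hρ fun y => ‖G y‖ ^ 2, Real.sqrt_mul (by positivity)] at hbound
  have hlow : ρ ^ 2 * N ^ 2 ≤
      ∫ s, J (planeMap e z s) * G (similarity e z ρ (planeMap e z s)) := by
    have e1 : ∫ s, J (planeMap e z s) * G (similarity e z ρ (planeMap e z s)) =
        ρ ^ 2 * ∫ s, f s * G (planeEmb s) := by
      rw [← integral_comp_inv_smul_plane hρ fun s => f s * G (planeEmb s)]
      simp_rw [hfJ, similarity_planeMap]
    rw [e1, hN, Real.sq_sqrt (integral_nonneg fun _ => sq_nonneg _)]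
    gcongr
    rw [← integral_indicator measurableSet_ball]
    refine integral_mono_of_nonneg (Filter.Eventually.of_forall fun y =>
      Set.indicator_nonneg (fun _ _ => sq_nonneg _) y) ?_ (Filter.Eventually.of_forall fun s => ?_)
    · refine (hfc.mul (hG.continuous.comp planeEmb.continuous)).integrable_of_hasCompactSupport ?_
      exact ((hasCompactSupport_cutoff_mul fun y => f (planeProj y)).comp_isClosedEmbedding
        planeEmb.isometry.isClosedEmbedding).mul_left
    · by_cases hs : s ∈ Metric.ball (0 : EuclideanSpace ℝ (Fin 2)) (1 / 2)
      · rw [Set.indicator_of_mem hs]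
        rw [mem_ball_zero_iff] at hs
        have hs' : cutoff (planeEmb s) = 1 := cutoff_eq_one (by rw [planeEmb.norm_map]; exact hs.le)
        simp [hG_def, hs', planeProj_planeEmb, sq]
      · rw [Set.indicator_of_notMem hs]
        change 0 ≤ f s * (cutoff (planeEmb s) * f (planeProj (planeEmb s)))
        rw [planeProj_planeEmb]
        have := mul_nonneg cutoff.nonneg (mul_self_nonneg (f s)) (a := cutoff (planeEmb s))
        linarith
  have hup : Real.sqrt (∫ s in Metric.closedBall 0 (R * ρ), J (planeMap e z s) ^ 2) ≤
      Real.sqrt (ρ ^ 2) * (C * N) := by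
    refine le_trans (le_of_eq ?_) (mul_le_mul_of_nonneg_left h3 (Real.sqrt_nonneg _))
    rw [← Real.sqrt_mul (by positivity),
      ← integral_indicator Metric.isClosed_closedBall.measurableSet,
      ← integral_indicator Metric.isClosed_closedBall.measurableSet,
      ← integral_comp_inv_smul_plane hρ]
    congr 2
    funext s
    have hiff : s ∈ Metric.closedBall (0 : EuclideanSpace ℝ (Fin 2)) (R * ρ) ↔
        ρ⁻¹ • s ∈ Metric.closedBall (0 : EuclideanSpace ℝ (Fin 2)) R := by
      rw [mem_closedBall_zero_iff, mem_closedBall_zero_iff, norm_smul,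
        Real.norm_of_nonneg (by positivity), mul_comm ρ⁻¹, ← div_eq_mul_inv, div_le_iff₀ hρ]
    by_cases hs : s ∈ Metric.closedBall (0 : EuclideanSpace ℝ (Fin 2)) (R * ρ)
    · rw [Set.indicator_of_mem hs, Set.indicator_of_mem (hiff.1 hs), hfJ]
    · rw [Set.indicator_of_notMem hs, Set.indicator_of_notMem (mt hiff.2 hs)]
  -- In terms of `t = √ρ` all powers of `ρ` become integral.
  set t := Real.sqrt ρ with ht
  have ht0 : 0 < t := Real.sqrt_pos.2 hρ
  have htρ : ρ = t ^ 2 := (Real.sq_sqrt hρ.le).symm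
  have ht3 : Real.sqrt (ρ ^ 3) = t ^ 3 := by
    rw [htρ, ← pow_mul, mul_comm, pow_mul, Real.sqrt_sq (by positivity)]
  rw [Real.sqrt_sq hρ.le] at hup
  rw [ht3] at hbound
  have hmain : t ^ 4 * N ^ 2 ≤ E * (t * (C * N) + ρ⁻¹ * (t ^ 3 * (C * N))) := by
    calc t ^ 4 * N ^ 2 = ρ ^ 2 * N ^ 2 := by rw [htρ]; ring
      _ ≤ _ := hlow.trans ((le_abs_self _).trans hbound)
      _ ≤ _ := by gcongr
  have hcancel : ρ⁻¹ * (t ^ 3 * (C * N)) = t * (C * N) := by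
    rw [htρ]; field_simp
  rw [hcancel] at hmain
  have hN' : t ^ 3 * N ≤ 2 * C * E := by
    rcases hN0.eq_or_lt with h0 | h0
    · rw [← h0, mul_zero]; positivity
    · refine le_of_mul_le_mul_right ?_ (mul_pos ht0 h0)
      linarith
  calc t * Real.sqrt (∫ s in Metric.closedBall 0 (R * ρ), J (planeMap e z s) ^ 2)
      ≤ t * (ρ * (C * N)) := by gcongr
    _ = C * (t ^ 3 * N) := by rw [htρ]; ring
    _ ≤ C * (2 * C * E) := by gcongr
    _ = 2 * C * C * E := by ring

/-! ### Local lower bounds for the error -/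

section LowerBounds

variable {Ω : Set E3}

lemma memLp_of_subset_closure (hΩ : IsLipschitzDomain Ω) (T : TetMesh Ω) {v : E3 → E3}
    (hv : MemLp v 2 (volume.restrict Ω)) {S : Set E3} (hS : S ⊆ closure Ω) :
    MemLp v 2 (volume.restrict S) := by
  rw [Measure.restrict_congr_set (T.ae_eq_closure hΩ)] at hv
  exact hv.mono_measure (Measure.restrict_mono hS le_rfl)

lemma l2Norm_mono {v : E3 → E3} {S S' : Set E3} (h : S ⊆ S')
    (hv : MemLp v 2 (volume.restrict S')) : l2Norm volume S v ≤ l2Norm volume S' v := by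
  refine Real.sqrt_le_sqrt (integral_mono_measure (Measure.restrict_mono h le_rfl)
    (Filter.Eventually.of_forall fun _ => sq_nonneg _) ?_)
  exact (memLp_two_iff_integrable_sq_norm hv.1).1 hv

lemma l2Norm_nonneg {V : Type*} [NormedAddCommGroup V] (μ : Measure E3) (S : Set E3) (g : E3 → V) :
    0 ≤ l2Norm μ S g := Real.sqrt_nonneg _

lemma TetMesh.hull_subset_closure (T : TetMesh Ω) {K : Finset E3} (hK : K ∈ T.tets) :
    hull K ⊆ closure Ω := by
  rw [T.cover]
  exact Set.subset_iUnion₂ (s := fun K _ => hull K) K hK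

lemma facePatch_subset_closure (T : TetMesh Ω) (F : Finset E3) :
    T.facePatch F ⊆ closure Ω :=
  Set.iUnion₂_subset fun _ hK => T.hull_subset_closure (Finset.mem_filter.1 hK).1

lemma elementPatch_subset_closure (T : TetMesh Ω) (K : Finset E3) :
    T.elementPatch K ⊆ closure Ω :=
  Set.iUnion₂_subset fun _ hK => T.hull_subset_closure hK.1

/-- Against gradients, a field `v` is controlled by its distance to an eigenfunction. -/
lemma abs_integral_inner_gradient_le (hΩ : IsLipschitzDomain Ω) (T : TetMesh Ω) {lam : ℝ}
    {u σ v : E3 → E3} (h : IsMixedEigensolution Ω (H0curl Ω) lam u σ)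
    (hv : MemLp v 2 (volume.restrict Ω)) {S : Set E3} (hS : S ⊆ closure Ω) {ψ : E3 → ℝ}
    (hψ : ContDiff ℝ ∞ ψ) (hψs : HasCompactSupport ψ) (hψS : tsupport ψ ⊆ S)
    (hψΩ : tsupport ψ ⊆ Ω) :
    |∫ x, inner ℝ (v x) (gradient ψ x)| ≤
      l2Norm volume S (u - v) * Real.sqrt (∫ x, ‖gradient ψ x‖ ^ 2) := by
  obtain ⟨c, hc, -⟩ := h.mem_left
  have hu' := memLp_of_subset_closure hΩ T hc.memLp hS
  have hv' := memLp_of_subset_closure hΩ T hv hS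
  have hg : MemLp (gradient ψ) 2 := memLp_gradient (hψ.of_le (by exact_mod_cast le_top)) hψs
  have hint : ∀ {w : E3 → E3}, MemLp w 2 (volume.restrict S) →
      Integrable (fun x => inner ℝ (w x) (gradient ψ x)) (volume.restrict S) := fun hw =>
    (integrable_norm_mul_norm hw (hg.restrict S)).mono'
      (hw.1.inner (hg.restrict S).1) (Filter.Eventually.of_forall fun x => norm_inner_le_norm _ _)
  have h1 : ∫ x, inner ℝ (v x) (gradient ψ x) =
      -∫ x in S, inner ℝ ((u - v) x) (gradient ψ x) := by
    have h0 : ∫ x in S, inner ℝ (v x) (gradient ψ x) = ∫ x, inner ℝ (v x) (gradient ψ x) :=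
      setIntegral_eq_integral_of_forall_compl_eq_zero fun x hx => by
        rw [gradient_eq_zero_of_notMem hψS hx, inner_zero_right]
    simp_rw [Pi.sub_apply, inner_sub_left]
    rw [integral_sub (hint hu') (hint hv'), h.setIntegral_inner_gradient hψ hψs hψS hψΩ, h0]
    ring
  rw [h1, abs_neg]
  exact abs_setIntegral_inner_le (hu'.sub hv') hg

lemma ball_subset_of_subset_closure (hΩ : IsLipschitzDomain Ω) {z : E3} {ρ : ℝ}
    (hball : Metric.ball z ρ ⊆ closure Ω) : Metric.ball z ρ ⊆ Ω :=
  (interior_maximal hball Metric.isOpen_ball).trans (interior_closure_subset hΩ.lipschitz)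

/-- The divergence of a piecewise polynomial field on an element bounds from below its distance to
an eigenfunction on that element. -/
lemma exists_div_bound (k : ℕ) (κ : ℝ) : ∃ C : ℝ, 0 < C ∧
    ∀ (Ω : Set E3), IsLipschitzDomain Ω → ∀ (lam : ℝ) (u σ : E3 → E3),
      IsMixedEigensolution Ω (H0curl Ω) lam u σ → ∀ (T : TetMesh Ω), T.IsShapeRegular κ →
      ∀ v : E3 → E3, MemLp v 2 (volume.restrict Ω) → ∀ p, T.IsPiecewise k v p →
      ∀ K ∈ T.tets, diam K * l2Norm volume (hull K) (p K).div ≤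
        C * l2Norm volume (hull K) (u - v) := by
  obtain ⟨C, hC, h⟩ := exists_ball_bound (k + 1) (2 * κ)
  refine ⟨(2 * |κ| + 1) * C, by positivity, fun Ω hΩ lam u σ hu T hT v hv p hp K hK => ?_⟩
  obtain ⟨z, r, hr, hball, hdiam⟩ := hT K hK
  have hzK : z ∈ hull K := hball (Metric.mem_closedBall_self hr.le)
  have hbK : Metric.ball z r ⊆ hull K := Metric.ball_subset_closedBall.trans hball
  have hbΩ := ball_subset_of_subset_closure hΩ (hbK.trans (T.hull_subset_closure hK))
  have hdiv := div_mem_polyFun (totalDegree_le_of_mem_localNedelec (hp K hK).1)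
  have key := h z r hr _ hdiv (l2Norm volume (hull K) (u - v)) (l2Norm_nonneg _ _ _)
    fun ψ hψ hψs hsub => by
      have h1 := abs_integral_inner_gradient_le hΩ T hu hv (T.hull_subset_closure hK) hψ hψs
        (hsub.trans hbK) (hsub.trans hbΩ)
      have h2 : ∫ x, inner ℝ (v x) (gradient ψ x) = -∫ x, (p K).div x * ψ x := by
        rw [← integral_inner_gradient (p K) (hψ.of_le (by exact_mod_cast le_top)) hψs]
        have hae := (ae_restrict_iff' (isCompact_hull K).measurableSet).1 (hp K hK).2
        refine integral_congr_ae (hae.mono fun x hx => ?_)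
        by_cases hxK : x ∈ hull K
        · simp only [hx hxK]
        · simp only [gradient_eq_zero_of_notMem (hsub.trans hbK) hxK, inner_zero_right]
      rwa [h2, abs_neg] at h1
  have h3 : l2Norm volume (hull K) (p K).div ≤
      Real.sqrt (∫ x in Metric.closedBall z (2 * κ * r), (p K).div x ^ 2) := by
    refine Real.sqrt_le_sqrt ?_
    simp only [Real.norm_eq_abs, sq_abs]
    refine setIntegral_mono_set ?_ (Filter.Eventually.of_forall fun _ => sq_nonneg _)
      (LE.le.eventuallyLE ?_)
    · exact ((continuous_div (p K)).pow 2).continuousOn.integrableOn_compact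
        (isCompact_closedBall _ _)
    · exact (hull_subset_closedBall hzK).trans (Metric.closedBall_subset_closedBall (by linarith))
  have hd : diam K ≤ (2 * |κ| + 1) * r := by
    have := mul_le_mul_of_nonneg_right (le_abs_self κ) (by positivity : 0 ≤ 2 * r)
    linarith
  calc diam K * l2Norm volume (hull K) (p K).div
      ≤ ((2 * |κ| + 1) * r) *
        Real.sqrt (∫ x in Metric.closedBall z (2 * κ * r), (p K).div x ^ 2) :=
        mul_le_mul hd h3 (l2Norm_nonneg _ _ _) (by positivity)
    _ = (2 * |κ| + 1) *
        (r * Real.sqrt (∫ x in Metric.closedBall z (2 * κ * r), (p K).div x ^ 2)) := by ring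
    _ ≤ (2 * |κ| + 1) * (C * l2Norm volume (hull K) (u - v)) := by gcongr
    _ = (2 * |κ| + 1) * C * l2Norm volume (hull K) (u - v) := by ring

/-- Some linear isometry makes a given unit vector vertical. -/
lemma exists_isometry_single {n : E3} (hn : ‖n‖ = 1) :
    ∃ e : E3 ≃ₗᵢ[ℝ] E3, e n = EuclideanSpace.single 2 1 :=
  ⟨_, Submodule.reflection_sub (v := n) (w := EuclideanSpace.single 2 1) (by simp [hn])⟩

lemma isometry_sub_faceCenter_apply_two {e : E3 ≃ₗᵢ[ℝ] E3} {n : E3}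
    (he : e n = EuclideanSpace.single 2 1) (F : Finset E3) (x : E3) : e (x - faceCenter F) 2 = height n F x := by
  rw [height_apply, ← e.inner_map_map, he, EuclideanSpace.inner_single_left]
  simp

lemma hull_subset_range_planeMap {F : Finset E3} (hF : F.card = 3) {n : E3}
    (hn : IsUnitNormal F n) {e : E3 ≃ₗᵢ[ℝ] E3} (he : e n = EuclideanSpace.single 2 1) :
    hull F ⊆ Set.range (planeMap e (faceCenter F)) := by
  intro x hx
  have hc : Convex ℝ {y | height n F y = 0} :=
    (convex_singleton (0 : ℝ)).affine_preimage (height n F)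
  have hx0 : height n F x = 0 := convexHull_min (fun v hv => height_vertex hF hn hv) hc hx
  refine ⟨planeProj (e (x - faceCenter F)), ?_⟩
  rw [planeMap, planeEmb_planeProj (by rw [isometry_sub_faceCenter_apply_two he, hx0])]
  simp

/-- The surface integral over a face, in coordinates of its plane. -/
lemma l2Norm_hull_le {F : Finset E3} (hF : F.card = 3) {n : E3} (hn : IsUnitNormal F n)
    {e : E3 ≃ₗᵢ[ℝ] E3} (he : e n = EuclideanSpace.single 2 1) {J : E3 → ℝ} (hJ : Continuous J) :
    l2Norm μHE[2] (hull F) J ≤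
      Real.sqrt (∫ s in Metric.closedBall 0 (diam F), J (planeMap e (faceCenter F) s) ^ 2) := by
  have hiso := isometry_planeMap e (faceCenter F)
  have hmap : (μHE[2] : Measure E3).restrict (hull F) =
      (volume.map (planeMap e (faceCenter F))).restrict (hull F) := by
    rw [← EuclideanSpace.euclideanHausdorffMeasure_eq_volume, hiso.map_euclideanHausdorffMeasure,
      Measure.restrict_restrict (isCompact_hull F).measurableSet,
      Set.inter_eq_left.2 (hull_subset_range_planeMap hF hn he)]
  rw [l2Norm, hmap, hiso.isClosedEmbedding.measurableEmbedding.setIntegral_map]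
  simp only [Real.norm_eq_abs, sq_abs]
  refine Real.sqrt_le_sqrt (setIntegral_mono_set ?_
    (Filter.Eventually.of_forall fun _ => sq_nonneg _) (LE.le.eventuallyLE ?_))
  · exact ((hJ.comp hiso.continuous).pow 2).continuousOn.integrableOn_compact
      (isCompact_closedBall _ _)
  · intro s hs
    have h1 := hull_subset_closedBall (faceCenter_mem_hull hF) hs
    have h2 : planeMap e (faceCenter F) 0 = faceCenter F := by simp [planeMap]
    rw [Metric.mem_closedBall] at h1 ⊢
    rwa [← hiso.dist_eq, h2]

lemma abs_setIntegral_mul_le {f ψ : E3 → ℝ} (hf : Continuous f) (hψ : Continuous ψ)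
    (hψs : HasCompactSupport ψ) {A S : Set E3} (hA : MeasurableSet A) (hS : IsCompact S)
    (hAS : ∀ x ∈ A, ψ x ≠ 0 → x ∈ S) :
    |∫ x in A, f x * ψ x| ≤ l2Norm volume S f * Real.sqrt (∫ x, ‖ψ x‖ ^ 2) := by
  have hψ2 : MemLp ψ 2 := hψ.memLp_of_hasCompactSupport hψs
  have hf2 : MemLp f 2 (volume.restrict S) := memLp_restrict_of_isBounded hf hS.isBounded
  have hint := integrable_norm_mul_norm hf2 (hψ2.restrict S)
  rw [← Real.norm_eq_abs]
  refine (norm_integral_le_integral_norm _).trans ?_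
  have h1 : ∫ x in A, ‖f x * ψ x‖ ≤ ∫ x in S, ‖f x‖ * ‖ψ x‖ := by
    rw [← integral_indicator hA, ← integral_indicator hS.measurableSet]
    refine integral_mono_of_nonneg (Filter.Eventually.of_forall fun x =>
      Set.indicator_nonneg (fun _ _ => norm_nonneg _) x)
      ((integrable_indicator_iff hS.measurableSet).2 hint) (Filter.Eventually.of_forall fun x => ?_)
    have hnn : 0 ≤ S.indicator (fun x => ‖f x‖ * ‖ψ x‖) x :=
      Set.indicator_nonneg (fun _ _ => by positivity) x
    by_cases hx : x ∈ A
    · by_cases hx0 : ψ x = 0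
      · simpa [Set.indicator_of_mem hx, hx0] using hnn
      · simp only [Set.indicator_of_mem hx, Set.indicator_of_mem (hAS x hx hx0), norm_mul, le_refl]
    · rw [Set.indicator_of_notMem hx]
      exact hnn
  refine (h1.trans (integral_norm_mul_norm_le hf2 (hψ2.restrict S))).trans ?_
  rw [l2Norm]
  gcongr
  · exact Filter.Eventually.of_forall fun x => by positivity
  · exact (memLp_two_iff_integrable_sq_norm hψ2.1).1 hψ2
  · exact Measure.restrict_le_self

/-- Green's formula on both sides of a plane, for a field that is a polynomial on each side. -/
lemma integral_jump_eq {p q : PolyField} {v : E3 → E3} {ψ : E3 → ℝ} (hψ : ContDiff ℝ 1 ψ)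
    (hψs : HasCompactSupport ψ) {e : E3 ≃ₗᵢ[ℝ] E3} {n : E3}
    (he : e n = EuclideanSpace.single 2 1) (z : E3)
    (hp : ∀ᵐ x, x ∈ halfSpace e z → x ∈ tsupport ψ → v x = p.eval x)
    (hq : ∀ᵐ x, x ∉ halfSpace e z → x ∈ tsupport ψ → v x = q.eval x) :
    ∫ s, (inner ℝ (p.eval (planeMap e z s)) n - inner ℝ (q.eval (planeMap e z s)) n) *
        ψ (planeMap e z s) =
      -(∫ x in halfSpace e z, p.div x * ψ x) - (∫ x in (halfSpace e z)ᶜ, q.div x * ψ x) -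
        ∫ x, inner ℝ (v x) (gradient ψ x) := by
  have hm := measurableSet_halfSpace e z
  have hgp := integrable_inner_gradient (continuous_eval p) hψ hψs
  have hgq := integrable_inner_gradient (continuous_eval q) hψ hψs
  have hdq := integrable_mul_of_hasCompactSupport (continuous_div q) hψ.continuous hψs
  have e1 := setIntegral_halfSpace_inner_gradient p hψ hψs he z
  have e2 := setIntegral_halfSpace_inner_gradient q hψ hψs he z
  have e3 := integral_inner_gradient q hψ hψs
  rw [← integral_add_compl hm hgq, ← integral_add_compl hm hdq] at e3
  have hvp : (fun x => inner ℝ (p.eval x) (gradient ψ x)) =ᵐ[volume.restrict (halfSpace e z)]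
      fun x => inner ℝ (v x) (gradient ψ x) := by
    refine (ae_restrict_iff' hm).2 (hp.mono fun x hx hxH => ?_)
    by_cases hxs : x ∈ tsupport ψ
    · simp only [hx hxH hxs]
    · simp only [gradient_eq_zero_of_notMem subset_rfl hxs, inner_zero_right]
  have hvq : (fun x => inner ℝ (q.eval x) (gradient ψ x)) =ᵐ[volume.restrict (halfSpace e z)ᶜ]
      fun x => inner ℝ (v x) (gradient ψ x) := by
    refine (ae_restrict_iff' hm.compl).2 (hq.mono fun x hx hxH => ?_)
    by_cases hxs : x ∈ tsupport ψ
    · simp only [hx hxH hxs]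
    · simp only [gradient_eq_zero_of_notMem subset_rfl hxs, inner_zero_right]
  have hv : Integrable fun x => inner ℝ (v x) (gradient ψ x) := by
    rw [← integrableOn_univ, ← Set.union_compl_self (halfSpace e z), integrableOn_union]
    exact ⟨hgp.integrableOn.congr hvp, hgq.integrableOn.congr hvq⟩
  have e4 := integral_add_compl hm hv
  rw [← integral_congr_ae hvp, ← integral_congr_ae hvq] at e4
  have hemb := (isometry_planeMap e z).isClosedEmbedding
  have hs : ∀ p : PolyField, Integrable fun s =>
      inner ℝ (p.eval (planeMap e z s)) n * ψ (planeMap e z s) := fun p =>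
    ((((continuous_eval p).comp hemb.continuous).inner continuous_const).mul
      (hψ.continuous.comp hemb.continuous)).integrable_of_hasCompactSupport
        (hψs.comp_isClosedEmbedding hemb).mul_left
  simp_rw [sub_mul]
  rw [integral_sub (hs p) (hs q)]
  simp only [planeMap]
  linarith

/-- The normal jump of a piecewise polynomial field across an interior face bounds from below its
distance to an eigenfunction on the two adjacent tetrahedra. -/
lemma exists_jump_bound (k : ℕ) {κ : ℝ} (hκ : 0 < κ) : ∃ C : ℝ, 0 < C ∧
    ∀ (Ω : Set E3), IsLipschitzDomain Ω → ∀ (lam : ℝ) (u σ : E3 → E3),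
      IsMixedEigensolution Ω (H0curl Ω) lam u σ → ∀ (T : TetMesh Ω), T.IsShapeRegular κ →
      ∀ v : E3 → E3, MemLp v 2 (volume.restrict Ω) → ∀ p, T.IsPiecewise k v p →
      ∀ F ∈ T.interiorFaces, ∀ n : E3, IsUnitNormal F n →
        Real.sqrt (diam F) * T.jumpNorm p n F ≤
          C * l2Norm volume (T.facePatch F) (u - v) := by
  obtain ⟨C₁, hC₁, hdivb⟩ := exists_div_bound k κ
  obtain ⟨C₂, hC₂, htrace⟩ := exists_trace_bound (k + 1) (6 * κ)
  refine ⟨Real.sqrt (6 * κ) * (C₂ * (1 + 2 * C₁ / (6 * κ))), by positivity,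
    fun Ω hΩ lam u σ hu T hT v hv p hp F hF n hn => ?_⟩
  obtain ⟨a, b, haF, hbF, hha, hhb, htets⟩ := T.exists_two_tets hT hΩ.isOpen hF hn
  obtain ⟨ha, hFa⟩ := (htets _).2 (Or.inl rfl)
  obtain ⟨hb, hFb⟩ := (htets _).2 (Or.inr rfl)
  set z := faceCenter F with hz
  set D := l2Norm volume (T.facePatch F) (u - v) with hD
  have hD0 : 0 ≤ D := l2Norm_nonneg _ _ _
  obtain ⟨c, hc, -⟩ := hu.mem_left
  have hmem : MemLp (u - v) 2 (volume.restrict (T.facePatch F)) :=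
    (memLp_of_subset_closure hΩ T hc.memLp (facePatch_subset_closure T F)).sub
      (memLp_of_subset_closure hΩ T hv (facePatch_subset_closure T F))
  have hpatch : ∀ K ∈ T.tets, F ⊆ K → hull K ⊆ T.facePatch F := fun K hK hFK =>
    Set.subset_iUnion₂ (s := fun K (_ : K ∈ ({K' ∈ T.tets | F ⊆ K'} : Finset (Finset E3))) =>
      hull K) K (Finset.mem_filter.2 ⟨hK, hFK⟩)
  -- The size of the face is comparable to the inradii of the two tetrahedra.
  have hF0 : 0 < diam F := by
    obtain ⟨lam, hlam⟩ := exists_isBarycentric (T.card_eq _ ha) (T.indep _ ha)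
    obtain ⟨y, r, hr, hball, -⟩ := hT _ ha
    obtain ⟨x₁, hx₁, x₂, hx₂, hne⟩ := Finset.one_lt_card.1 (by rw [hF.1]; norm_num : 1 < F.card)
    exact hr.trans_le ((hlam.le_dist hr hball (hFa hx₁) (hFa hx₂) hne.symm).trans
      (Metric.dist_le_diam_of_mem (isBounded_hull F) (subset_convexHull ℝ _ hx₁)
        (subset_convexHull ℝ _ hx₂)))
  set ρ := diam F / (6 * κ) with hρ
  have hρ0 : 0 < ρ := by positivity
  have hRρ : 6 * κ * ρ = diam F := by rw [hρ]; field_simp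
  -- Since `ρ` is at most a third of either inradius, each half of the ball lies in a tetrahedron.
  have hhalf : ∀ c, c ∉ F → insert c F ∈ T.tets → ∀ x ∈ Metric.ball z ρ,
      0 ≤ height n F x * height n F c → x ∈ hull (insert c F) := by
    intro c hcF hc x hx hside
    obtain ⟨lam, hlam⟩ := exists_isBarycentric (T.card_eq _ hc) (T.indep _ hc)
    obtain ⟨y, r, hr, hball, hdiam⟩ := hT _ hc
    refine hlam.mem_hull_of_dist_le hr hball hF.1 hcF rfl hn (hx.le.trans ?_) hside
    rw [hρ, div_le_iff₀ (by positivity)]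
    have := diam_mono (Finset.subset_insert c F)
    linarith
  have hdivK : ∀ K ∈ T.tets, F ⊆ K →
      l2Norm volume (hull K) (p K).div ≤ C₁ / (6 * κ) * D * ρ⁻¹ := by
    intro K hK hFK
    have h1 := hdivb Ω hΩ lam u σ hu T hT v hv p hp K hK
    have h2 := l2Norm_mono (hpatch K hK hFK) hmem
    have h3 : diam F * l2Norm volume (hull K) (p K).div ≤ C₁ * D :=
      (mul_le_mul_of_nonneg_right (diam_mono hFK) (l2Norm_nonneg _ _ _)).trans
        (h1.trans (by gcongr))
    have h4 : C₁ / (6 * κ) * D * ρ⁻¹ = C₁ * D / diam F := by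
      rw [hρ]; field_simp
    rw [h4, le_div_iff₀ hF0]
    linarith
  obtain ⟨e, he⟩ := exists_isometry_single hn.1
  have hH : ∀ x, x ∈ halfSpace e z ↔ 0 < height n F x := fun x => by
    rw [halfSpace, Set.mem_ofPred_eq, isometry_sub_faceCenter_apply_two he]
  have hup : ∀ x ∈ Metric.ball z ρ, x ∈ halfSpace e z → x ∈ hull (insert a F) := fun x hx hxH =>
    hhalf a haF ha x hx (mul_pos ((hH x).1 hxH) hha).le
  have hdown : ∀ x ∈ Metric.ball z ρ, x ∉ halfSpace e z → x ∈ hull (insert b F) :=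
    fun x hx hxH => hhalf b hbF hb x hx
      (mul_nonneg_of_nonpos_of_nonpos (not_lt.1 (mt (hH x).2 hxH)) hhb.le)
  have hballS : Metric.ball z ρ ⊆ T.facePatch F := fun x hx => by
    by_cases hxH : x ∈ halfSpace e z
    · exact hpatch _ ha hFa (hup x hx hxH)
    · exact hpatch _ hb hFb (hdown x hx hxH)
  have hballΩ := ball_subset_of_subset_closure hΩ
    (hballS.trans (facePatch_subset_closure T F))
  set J : E3 → ℝ := (fun x => inner ℝ ((p (insert a F)).eval x) n) -
    fun x => inner ℝ ((p (insert b F)).eval x) n with hJ_def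
  have hJ : J ∈ polyFun (Fin 3) (k + 1) := Submodule.sub_mem _
    (inner_eval_mem_polyFun (totalDegree_le_of_mem_localNedelec (hp _ ha).1) n)
    (inner_eval_mem_polyFun (totalDegree_le_of_mem_localNedelec (hp _ hb).1) n)
  have hjump : T.normalJump p n F = J := by
    have hne : insert a F ≠ insert b F := fun h => by
      have : a ∈ insert b F := h ▸ Finset.mem_insert_self a F
      rcases Finset.mem_insert.1 this with h' | h'
      · rw [h'] at hha; exact lt_asymm hha hhb
      · exact haF h'
    have hfilter : {K ∈ T.tets | F ⊆ K} = {insert a F, insert b F} := by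
      ext K
      rw [Finset.mem_filter, htets, Finset.mem_insert, Finset.mem_singleton]
    funext x
    rw [TetMesh.normalJump, hfilter, Finset.sum_pair hne, side_insert haF, side_insert hbF,
      Real.sign_of_pos hha, Real.sign_of_neg hhb, hJ_def, Pi.sub_apply]
    ring
  have key := htrace e z ρ hρ0 J hJ ((1 + 2 * C₁ / (6 * κ)) * D) (by positivity)
    fun ψ hψ hψs hsub => by
      have hψ1 : ContDiff ℝ 1 ψ := hψ.of_le (by exact_mod_cast le_top)
      have h1 := abs_integral_inner_gradient_le hΩ T hu hv (facePatch_subset_closure T F) hψ hψs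
        (hsub.trans hballS) (hsub.trans hballΩ)
      have haea := (ae_restrict_iff' (isCompact_hull _).measurableSet).1 (hp _ ha).2
      have haeb := (ae_restrict_iff' (isCompact_hull _).measurableSet).1 (hp _ hb).2
      have h2 := integral_jump_eq hψ1 hψs he z
        (haea.mono fun x hx hxH hxs => hx (hup x (hsub hxs) hxH))
        (haeb.mono fun x hx hxH hxs => hx (hdown x (hsub hxs) hxH))
      have h3 := abs_setIntegral_mul_le (continuous_div (p (insert a F))) hψ1.continuous hψs
        (measurableSet_halfSpace e z) (isCompact_hull (insert a F))
        (fun x hxH hx0 => hup x (hsub (subset_tsupport ψ hx0)) hxH)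
      have h4 := abs_setIntegral_mul_le (continuous_div (p (insert b F))) hψ1.continuous hψs
        (measurableSet_halfSpace e z).compl (isCompact_hull (insert b F))
        (fun x hxH hx0 => hdown x (hsub (subset_tsupport ψ hx0)) hxH)
      set N₀ := Real.sqrt (∫ x, ‖ψ x‖ ^ 2) with hN₀
      set N₁ := Real.sqrt (∫ x, ‖gradient ψ x‖ ^ 2) with hN₁
      have hN₀0 : 0 ≤ N₀ := Real.sqrt_nonneg _
      have hN₁0 : 0 ≤ N₁ := Real.sqrt_nonneg _
      have h5 := h3.trans (mul_le_mul_of_nonneg_right (hdivK _ ha hFa) hN₀0)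
      have h6 := h4.trans (mul_le_mul_of_nonneg_right (hdivK _ hb hFb) hN₀0)
      simp only [hJ_def, Pi.sub_apply]
      rw [h2]
      refine (abs_sub _ _).trans ?_
      have h7 := abs_sub (-∫ x in halfSpace e z, (p (insert a F)).div x * ψ x)
        (∫ x in (halfSpace e z)ᶜ, (p (insert b F)).div x * ψ x)
      rw [abs_neg] at h7
      have h8 : 0 ≤ 2 * C₁ / (6 * κ) * D * N₁ := by positivity
      have h9 : 0 ≤ D * (ρ⁻¹ * N₀) := by positivity
      have h10 : (1 + 2 * C₁ / (6 * κ)) * D * (N₁ + ρ⁻¹ * N₀) = D * N₁ +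
          2 * (C₁ / (6 * κ) * D * ρ⁻¹ * N₀) + 2 * C₁ / (6 * κ) * D * N₁ + D * (ρ⁻¹ * N₀) := by
        ring
      rw [h10]
      linarith
  rw [hRρ] at key
  have hnorm := l2Norm_hull_le hF.1 hn he (contDiff_of_mem_polyFun hJ (n := 0)).continuous
  rw [TetMesh.jumpNorm, hjump]
  calc Real.sqrt (diam F) * l2Norm μHE[2] (hull F) J
      ≤ Real.sqrt (diam F) *
        Real.sqrt (∫ s in Metric.closedBall 0 (diam F), J (planeMap e z s) ^ 2) := by gcongr
    _ = Real.sqrt (6 * κ) * (Real.sqrt ρ *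
        Real.sqrt (∫ s in Metric.closedBall 0 (diam F), J (planeMap e z s) ^ 2)) := by
        rw [← mul_assoc, ← Real.sqrt_mul (by positivity : 0 ≤ 6 * κ), hRρ]
    _ ≤ Real.sqrt (6 * κ) * (C₂ * ((1 + 2 * C₁ / (6 * κ)) * D)) := by gcongr
    _ = Real.sqrt (6 * κ) * (C₂ * (1 + 2 * C₁ / (6 * κ))) * D := by ring

lemma facePatch_subset_elementPatch (T : TetMesh Ω) {F K : Finset E3} (hF : F.card = 3)
    (hFK : F ⊆ K) : T.facePatch F ⊆ T.elementPatch K :=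
  Set.iUnion₂_subset fun K' hK' =>
    Set.subset_iUnion₂ (s := fun K' (_ : K' ∈ {K' : Finset E3 | K' ∈ T.tets ∧
      ∃ F : Finset E3, F.card = 3 ∧ F ⊆ K ∧ F ⊆ K'}) => hull K') K'
      ⟨(Finset.mem_filter.1 hK').1, F, hF, hFK, (Finset.mem_filter.1 hK').2⟩

lemma hull_subset_elementPatch (T : TetMesh Ω) {K : Finset E3} (hK : K ∈ T.tets) :
    hull K ⊆ T.elementPatch K := by
  obtain ⟨F, hFK, hF⟩ := Finset.exists_subset_card_eq (s := K) (n := 3)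
    (by rw [T.card_eq K hK]; norm_num)
  exact Set.subset_iUnion₂ (s := fun K' (_ : K' ∈ {K' : Finset E3 | K' ∈ T.tets ∧
      ∃ F : Finset E3, F.card = 3 ∧ F ⊆ K ∧ F ⊆ K'}) => hull K') K ⟨hK, F, hF, hFK, hFK⟩

/-- The indicator is bounded by the sum of the bounds for its parts, as a tetrahedron has four
faces. -/
lemma indicator_le (T : TetMesh Ω) {K : Finset E3} (hK : K ∈ T.tets) {p : Finset E3 → PolyField}
    {n : Finset E3 → E3} {A B : ℝ} (hA : 0 ≤ A) (hB : 0 ≤ B)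
    (h1 : diam K * l2Norm volume (hull K) (p K).div ≤ A)
    (h2 : ∀ F ∈ T.interiorFaces, F ⊆ K → Real.sqrt (diam F) * T.jumpNorm p (n F) F ≤ B) :
    T.indicator p n K ≤ A + B := by
  classical
  rw [TetMesh.indicator]
  refine Real.sqrt_le_iff.2 ⟨by positivity, ?_⟩
  have h3 : diam K ^ 2 * l2Norm volume (hull K) (p K).div ^ 2 ≤ A ^ 2 := by
    rw [← mul_pow]
    exact pow_le_pow_left₀ (mul_nonneg (diam_nonneg K) (l2Norm_nonneg _ _ _)) h1 2
  have h4 : ∀ F ∈ (K.powersetCard 3).filter (· ∈ T.interiorFaces),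
      diam F / 4 * T.jumpNorm p (n F) F ^ 2 ≤ B ^ 2 / 4 := by
    intro F hF
    rw [Finset.mem_filter, Finset.mem_powersetCard] at hF
    have h5 := pow_le_pow_left₀ (mul_nonneg (Real.sqrt_nonneg _) (l2Norm_nonneg _ _ _))
      (h2 F hF.2 hF.1.1) 2
    rw [mul_pow, Real.sq_sqrt (diam_nonneg F)] at h5
    change diam F * T.jumpNorm p (n F) F ^ 2 ≤ B ^ 2 at h5
    linarith
  have h6 := Finset.sum_le_card_nsmul _ _ _ h4
  have h7 : ((K.powersetCard 3).filter (· ∈ T.interiorFaces)).card ≤ 4 :=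
    (Finset.card_filter_le _ _).trans (by rw [Finset.card_powersetCard, T.card_eq K hK]; decide)
  have h8 : (((K.powersetCard 3).filter (· ∈ T.interiorFaces)).card : ℝ) ≤ 4 := by exact_mod_cast h7
  rw [nsmul_eq_mul] at h6
  have h9 := mul_le_mul_of_nonneg_right h8 (by positivity : 0 ≤ B ^ 2 / 4)
  have h10 := mul_nonneg hA hB
  refine (add_le_add h3 ((le_of_eq ?_).trans (h6.trans h9))).trans (by nlinarith)
  congr!

end LowerBounds

end MaxwellFE

theorem mainTheorem3 (k : ℕ) (κ : ℝ) :
    ∃ C : ℝ, 0 < C ∧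
      ∀ (Ω : Set MaxwellFE.E3), MaxwellFE.IsLipschitzDomain Ω →
      ∀ (lam : ℝ) (u σ : MaxwellFE.E3 → MaxwellFE.E3),
        MaxwellFE.IsMixedEigensolution Ω (MaxwellFE.H0curl Ω) lam u σ →
      ∀ (T : MaxwellFE.TetMesh Ω), T.IsShapeRegular κ →
      ∀ (lamh : ℝ) (uh σh : MaxwellFE.E3 → MaxwellFE.E3),
        MaxwellFE.IsMixedEigensolution Ω (T.nedelecSpace k) lamh uh σh →
      ∀ (p : Finset MaxwellFE.E3 → MaxwellFE.PolyField), T.IsPiecewise k uh p →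
      ∀ (n : Finset MaxwellFE.E3 → MaxwellFE.E3),
        (∀ F ∈ T.interiorFaces, MaxwellFE.IsUnitNormal F (n F)) →
        (∀ K ∈ T.tets,
          MaxwellFE.diam K * MaxwellFE.l2Norm MeasureTheory.volume (MaxwellFE.hull K) (p K).div
            ≤ C * MaxwellFE.l2Norm MeasureTheory.volume (MaxwellFE.hull K) (u - uh)) ∧
        (∀ F ∈ T.interiorFaces,
          Real.sqrt (MaxwellFE.diam F) * T.jumpNorm p (n F) F
            ≤ C * MaxwellFE.l2Norm MeasureTheory.volume (T.facePatch F) (u - uh)) ∧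
        (∀ K ∈ T.tets,
          T.indicator p n K
            ≤ C * MaxwellFE.l2Norm MeasureTheory.volume (T.elementPatch K) (u - uh)) := by
  open MaxwellFE in
  have hκ : 0 < max κ 1 := lt_max_of_lt_right one_pos
  -- If `κ ≤ 0`, then the mesh is empty; enlarging `κ` makes the constants positive in any case.
  obtain ⟨C₁, hC₁, hdiv⟩ := exists_div_bound k (max κ 1)
  obtain ⟨C₂, hC₂, hjump⟩ := exists_jump_bound k hκ
  refine ⟨C₁ + C₂, by positivity, fun Ω hΩ lam u σ hu T hT lamh uh σh huh p hp n hn => ?_⟩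
  have hT' : T.IsShapeRegular (max κ 1) := fun K hK => by
    obtain ⟨z, r, hr, hball, hdiam⟩ := hT K hK
    exact ⟨z, r, hr, hball, hdiam.trans (by gcongr; exact le_max_left _ _)⟩
  obtain ⟨⟨ch, hch, -⟩, -⟩ := huh.mem_left
  obtain ⟨c, hc, -⟩ := hu.mem_left
  have h1 := hdiv Ω hΩ lam u σ hu T hT' uh hch.memLp p hp
  have h2 := fun F hF => hjump Ω hΩ lam u σ hu T hT' uh hch.memLp p hp F hF (n F) (hn F hF)
  refine ⟨fun K hK => (h1 K hK).trans ?_, fun F hF => (h2 F hF).trans ?_, fun K hK => ?_⟩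
  · exact mul_le_mul_of_nonneg_right (by linarith) (l2Norm_nonneg _ _ _)
  · exact mul_le_mul_of_nonneg_right (by linarith) (l2Norm_nonneg _ _ _)
  · have hmem : MemLp (u - uh) 2 (volume.restrict (T.elementPatch K)) :=
      (memLp_of_subset_closure hΩ T hc.memLp (elementPatch_subset_closure T K)).sub
        (memLp_of_subset_closure hΩ T hch.memLp (elementPatch_subset_closure T K))
    have h0 := l2Norm_nonneg volume (T.elementPatch K) (u - uh)
    rw [add_mul]
    refine indicator_le T hK (by positivity) (by positivity) ((h1 K hK).trans ?_)
      fun F hF hFK => (h2 F hF).trans ?_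
    · gcongr
      exact l2Norm_mono (hull_subset_elementPatch T hK) hmem
    · gcongr
      exact l2Norm_mono (facePatch_subset_elementPatch T hF.1 hFK) hmem
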